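/- Let $\mathbb F_4=\{0,1,w,w^2\}$ with $w^2=w+1$, and let $D\subset\mathbb F_4^{12}$ be the dodecacode, i.e. the additive subgroup generated by the $12$ cyclic shifts of the word $w10100100101$. Let $D^-\subset\mathbb F_4^{11}$ be the additive code obtained from $D$ by deleting one (arbitrary) coordinate. Let $\Gamma=\Gamma_{D^-}$ be its coset graph: the vertices are the cosets of $D^-$ in $\mathbb F_4^{11}$, and two distinct cosets are adjacent if and only if their difference contains a vector of Hamming weight $1$. Theorem. The automorphism group $\mathrm{Aut}(\Gamma)$ has order $2^{10}\cdot 54$, acts transitively on the vertices, and has exactly two orbits on the edges, of sizes $2^9\cdot 6$ and $2^9\cdot 27$. The stabilizer of any vertex has a structure of type $(C_9\rtimes C_3)\rtimes C_2$, where both semidirect products are formed with nontrivial actions. For $g\in\mathrm{Aut}(\Gamma)$ of order $p$, the subgraph of $\Gamma$ induced on the vertices fixed by $g$ is, up to isomorphism, always one of the following, and each of the following combinations of a graph and an order $p$ occurs: (i) the whole graph $\Gamma$, $p=1$; (ii) the null graph (no fixed vertices), $p\in\{2,4,6,12,18\}$; (iii) the disjoint union of $8$ complete graphs of order $4$, $p=2$;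 (iv) the edge-free graph on $4$ vertices, $p=3$; (v) the Hamming graph $H(2,4)$, $p=3$; (vi) the edge-free graph on $2$ vertices, $p=6$; (vii) the one-vertex graph, $p=9$; (viii) the complete graph of order $4$, $p=9$. -/

import Mathlib

/-- Coordinate puncturing as an additive map: delete the `i`-th coordinate. -/
def deleteCoord {F : Type*} [Field F] {n : ℕ} (i : Fin (n + 1)) :
    (Fin (n + 1) → F) →+ (Fin n → F) where
  toFun x := fun j => x (i.succAbove j)
  map_zero' := rfl
  map_add' _ _ := rfl

/-- The code punctured at the `i`-th coordinate. -/
def puncturedCode {F : Type*} [Field F] {n : ℕ} (i : Fin (n + 1))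
    (C : AddSubgroup (Fin (n + 1) → F)) : AddSubgroup (Fin n → F) :=
  C.map (deleteCoord i)

/-- The generator word `w10100100101` of the dodecacode. -/
def dodecaWord {F : Type*} [Field F] (w : F) : Fin 12 → F :=
  ![w, 1, 0, 1, 0, 0, 1, 0, 0, 1, 0, 1]

/-- The dodecacode: the additive code of length 12 generated by all cyclic shifts of
`w10100100101`. -/
def dodecacode {F : Type*} [Field F] (w : F) : AddSubgroup (Fin 12 → F) :=
  AddSubgroup.closure (Set.range fun s : Fin 12 => fun j : Fin 12 => dodecaWord w (j - s))

/-- The coset graph of an additive code `C`: the vertices are the cosets of `C`, and two distinct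
cosets are adjacent when their difference contains a vector of Hamming weight one. -/
def cosetGraph {F : Type*} [Field F] [DecidableEq F] {n : ℕ} (C : AddSubgroup (Fin n → F)) :
    SimpleGraph ((Fin n → F) ⧸ C) where
  Adj a b := a ≠ b ∧ ∃ x : Fin n → F, hammingNorm x = 1 ∧ (QuotientAddGroup.mk x) = a - b
  symm := ⟨by
    rintro a b ⟨hab, x, hx, h⟩
    refine ⟨hab.symm, -x, ?_, ?_⟩
    · simpa [hammingNorm] using hx
    · rw [QuotientAddGroup.mk_neg, h, neg_sub]⟩
  loopless := ⟨fun _ h => h.1 rfl⟩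

/-- The orbit of an unordered pair of vertices under the automorphism group of the graph. -/
def edgeOrbit {V : Type*} (G : SimpleGraph V) (e : Sym2 V) : Set (Sym2 V) :=
  {f | ∃ g : G ≃g G, f = Sym2.map g e}

/-- The subgraph induced on the vertices that are fixed by the automorphism `g`. -/
def fixedSubgraph {V : Type*} (G : SimpleGraph V) (g : G ≃g G) : SimpleGraph {v : V | g v = v} :=
  G.induce {v : V | g v = v}

/-- `g` has order `p` and its fixed subgraph is isomorphic to `H`. -/
def HasFixedType {V W : Type*} (G : SimpleGraph V) (g : G ≃g G) (p : ℕ) (H : SimpleGraph W) :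
    Prop :=
  orderOf g = p ∧ Nonempty (fixedSubgraph G g ≃g H)

/-- The disjoint union of `m` complete graphs of order `k`. -/
def disjointCompletes (m k : ℕ) : SimpleGraph (Fin m × Fin k) where
  Adj a b := a.1 = b.1 ∧ a.2 ≠ b.2
  symm := ⟨fun _ _ h => ⟨h.1.symm, h.2.symm⟩⟩
  loopless := ⟨fun _ h => h.2 rfl⟩

/-- The Hamming graph `H(n, q)`. -/
def hammingGraph (n q : ℕ) : SimpleGraph (Fin n → Fin q) where
  Adj a b := hammingDist a b = 1
  symm := ⟨fun a b h => by rw [hammingDist_comm]; exact h⟩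
  loopless := ⟨fun a h => by simp at h⟩

/-! A check matrix of D⁻ identifies the cosets with syndromes in F₂¹⁰ and Γ with the Cayley graph of
F₂¹⁰ whose connection set S consists of the 33 syndromes of words of weight one (11 coordinates,
three nonzero symbols each). As D is cyclic, the choice of the deleted coordinate is immaterial.

D⁻ has minimum distance 5, so S is rigid. If s + t is nonzero and outside S, then {s, t} is the only
pair in S with that sum (`eq_or_eq_of_isConn_add`), and the 4-cliques through 0 are the subgroups
given by the single coordinates (`eq_add_of_isConn`). Automorphisms therefore respect parallelograms
with sides in S (`map_add_add`) and, since S generates, they are affine (`map_add_eq`). Hence Aut(Γ)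
consists of the translations composed with the linear maps preserving S. A backtracking search run
by the kernel shows that these are the 54 products AⁱBʲCᵏ, where BAB⁻¹ = A⁴, CAC⁻¹ = A⁻¹ and CB =
BC.

Up to translation an edge is its difference, so edge orbits are orbits of the stabilizer on S; their
sizes are 6 (two coordinates) and 27 (the other nine). An automorphism with a fixed vertex is
conjugate by a translation to a linear one, which leaves ten classes to inspect. Without a fixed
vertex, let m be the order of the linear part, one of 1, 2, 3, 6, 9. The m-th power is a
translation, so the order is m or 2m; a power of 3 is impossible because 3 does not divide 2¹⁰. This
leaves 2, 4, 6, 12, 18. -/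

/-! ### Binary vectors and additive maps given by images of unit vectors -/

/-- Binary vectors of length `n`, stored as bit vectors and added by exclusive or. -/
def BinVec (n : ℕ) : Type := BitVec n

namespace BinVec

instance (n : ℕ) : DecidableEq (BinVec n) := inferInstanceAs (DecidableEq (BitVec n))

/-- The number whose binary digits are the entries of `x`. -/
def toNat {n : ℕ} (x : BinVec n) : ℕ := BitVec.toNat x

/-- The vector of the `n` lowest binary digits of `m`. -/
def ofNat {n : ℕ} (m : ℕ) : BinVec n := BitVec.ofNat n m

instance (n : ℕ) : Add (BinVec n) := ⟨fun x y => BitVec.xor x y⟩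
instance (n : ℕ) : Zero (BinVec n) := ⟨BitVec.zero n⟩
instance (n : ℕ) : Neg (BinVec n) := ⟨id⟩

instance (n : ℕ) : AddCommGroup (BinVec n) where
  add_assoc := BitVec.xor_assoc
  add_comm := BitVec.xor_comm
  zero_add _ := BitVec.zero_xor
  add_zero _ := BitVec.xor_zero
  neg_add_cancel _ := BitVec.xor_self
  nsmul := nsmulRec
  zsmul := zsmulRec

variable {n : ℕ}

theorem add_self (x : BinVec n) : x + x = 0 := BitVec.xor_self

theorem neg_eq (x : BinVec n) : -x = x := rfl

theorem sub_eq_add (x y : BinVec n) : x - y = x + y := rfl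

theorem add_eq_zero_iff {x y : BinVec n} : x + y = 0 ↔ x = y := by
  rw [← sub_eq_add, sub_eq_zero]

theorem add_add_cancel (x y : BinVec n) : x + (x + y) = y := by
  rw [← add_assoc, add_self, zero_add]

theorem add_eq_iff {x y z : BinVec n} : x + y = z ↔ y = x + z := by
  rw [← sub_eq_add x z, ← neg_eq (x - z), neg_sub, eq_sub_iff_add_eq, add_comm]

theorem toNat_add (x y : BinVec n) : (x + y).toNat = x.toNat ^^^ y.toNat := BitVec.toNat_xor x y

theorem toNat_zero : (0 : BinVec n).toNat = 0 := BitVec.toNat_ofNat 0 n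

theorem toNat_lt (x : BinVec n) : x.toNat < 2 ^ n := BitVec.isLt x

theorem toNat_injective : Function.Injective (toNat : BinVec n → ℕ) :=
  fun _ _ h => BitVec.eq_of_toNat_eq h

theorem ofNat_toNat (x : BinVec n) : ofNat x.toNat = x := BitVec.ofNat_toNat n x |>.trans (BitVec.setWidth_eq x)

theorem toNat_ofNat (m : ℕ) : (ofNat m : BinVec n).toNat = m % 2 ^ n := BitVec.toNat_ofNat m n

theorem toNat_ofNat_of_lt {m : ℕ} (h : m < 2 ^ n) : (ofNat m : BinVec n).toNat = m := by
  rw [toNat_ofNat, Nat.mod_eq_of_lt h]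

/-- Numbering of the binary vectors. -/
def equivFin (n : ℕ) : BinVec n ≃ Fin (2 ^ n) where
  toFun x := ⟨x.toNat, x.toNat_lt⟩
  invFun k := ofNat k
  left_inv x := ofNat_toNat x
  right_inv k := Fin.ext (toNat_ofNat_of_lt k.2)

instance (n : ℕ) : Fintype (BinVec n) := Fintype.ofEquiv _ (equivFin n).symm

theorem card_eq (n : ℕ) : Fintype.card (BinVec n) = 2 ^ n := by
  rw [Fintype.card_congr (equivFin n), Fintype.card_fin]

/-- Turns a statement about all vectors into a Boolean check over numerals, a form that kernel
evaluation handles well. -/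
theorem forall_of_all {p : BinVec n → Bool}
    (h : (List.range (2 ^ n)).all (fun m => p (ofNat m)) = true) (x : BinVec n) : p x = true := by
  rw [List.all_eq_true] at h
  simpa [ofNat_toNat] using h x.toNat (List.mem_range.2 x.toNat_lt)

end BinVec

/-- The combination of the entries of the list that is selected by the binary digits of a number. -/
def binComb {M : Type*} [AddCommGroup M] : List M → ℕ → M
  | [], _ => 0
  | a :: t, x => (if x % 2 = 1 then a else 0) + binComb t (x / 2)

theorem binComb_zero {M : Type*} [AddCommGroup M] (l : List M) : binComb l 0 = 0 := by
  induction l with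
  | nil => rfl
  | cons a t ih => simp [binComb, ih]

theorem binComb_xor {M : Type*} [AddCommGroup M] (h2 : ∀ a : M, a + a = 0) (l : List M) (x y : ℕ) :
    binComb l (x ^^^ y) = binComb l x + binComb l y := by
  induction l generalizing x y with
  | nil => simp [binComb]
  | cons a t ih =>
    have hm : (x ^^^ y) % 2 = 1 ↔ ¬ (x % 2 = 1 ↔ y % 2 = 1) := by
      rw [Nat.xor_mod_two_eq_one]
    have hd : (x ^^^ y) / 2 = (x / 2) ^^^ (y / 2) := Nat.xor_div_two
    simp only [binComb, hd, ih, hm]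
    by_cases hx : x % 2 = 1 <;> by_cases hy : y % 2 = 1 <;> simp [hx, hy]
    · rw [add_add_add_comm, h2, zero_add]
    · abel
    · abel

theorem map_binComb {M N : Type*} [AddCommGroup M] [AddCommGroup N] (f : M →+ N) (l : List M)
    (x : ℕ) : f (binComb l x) = binComb (l.map f) x := by
  induction l generalizing x with
  | nil => simp [binComb]
  | cons a t ih =>
    simp only [binComb, List.map, map_add, ih]
    split_ifs <;> simp

namespace BinVec

/-- The additive map that takes the `k`-th unit vector to the `k`-th entry of the list. -/
def linearMap {n : ℕ} {M : Type*} [AddCommGroup M] (h2 : ∀ a : M, a + a = 0) (l : List M) :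
    BinVec n →+ M where
  toFun x := binComb l x.toNat
  map_zero' := by rw [toNat_zero, binComb_zero]
  map_add' x y := by rw [toNat_add, binComb_xor h2]

/-- The endomorphism of `BinVec n` with the given images of the unit vectors. -/
def endo {n : ℕ} (l : List (BinVec n)) : BinVec n →+ BinVec n := linearMap add_self l

/-- The unit vectors of length 10. -/
def units : List (BinVec 10) := (List.range 10).map fun k => ofNat (2 ^ k)

theorem binComb_units (x : BinVec 10) : binComb units x.toNat = x := by
  have h := forall_of_all (p := fun x : BinVec 10 => decide (binComb units x.toNat = x))
    (by decide +kernel) x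
  exact of_decide_eq_true h

theorem addHom_eq_binComb {M : Type*} [AddCommGroup M] (f : BinVec 10 →+ M) (x : BinVec 10) :
    f x = binComb (units.map f) x.toNat := by
  rw [← map_binComb, binComb_units]

theorem addHom_ext {M : Type*} [AddCommGroup M] {f g : BinVec 10 →+ M}
    (h : ∀ u ∈ units, f u = g u) : f = g := by
  ext x
  rw [addHom_eq_binComb f, addHom_eq_binComb g, List.map_congr_left h]

end BinVec

/-! ### The connection set and its local structure -/

/-- The connection set of the syndrome graph as a bit mask. -/
def connMask : ℕ := 0x1000004000004800000000000000002000000008000080000040000000000000000000000000000020000400000000000800000010000400000800000000000001000040000000000000000000040000000000001000000000080000108000000000000010020000000000001000100010001111e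

/-- Membership of a number in the connection set. -/
def inConn (x : ℕ) : Bool := Nat.beq (Nat.land (Nat.shiftRight connMask x) 1) 1

/-- The elements of the connection set. -/
def connList : List ℕ := 
  [1, 2, 3, 4, 8, 12, 16, 32, 48, 64, 117, 128, 187, 192, 215, 256, 310, 394, 412, 471, 494, 512,
  543, 590, 609, 730, 755, 775, 809, 879, 882, 906, 928]

/-- Connection set of the syndrome graph: the syndromes of the vectors of weight one. -/
def IsConn (x : BinVec 10) : Prop := inConn x.toNat = true

instance : DecidablePred IsConn := fun x => inferInstanceAs (Decidable (inConn x.toNat = true))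

open BinVec

/-- The mask gives a fast membership test, the list a short enumeration; finite checks use whichever
is cheaper. -/
theorem isConn_iff_mem (x : BinVec 10) : IsConn x ↔ x.toNat ∈ connList := by
  have h := forall_of_all (p := fun x => decide (IsConn x ↔ x.toNat ∈ connList))
    (by decide +kernel) x
  exact of_decide_eq_true h

theorem not_isConn_zero : ¬ IsConn 0 := by decide +kernel

theorem IsConn.ne_zero {x : BinVec 10} (h : IsConn x) : x ≠ 0 := by
  rintro rfl
  exact not_isConn_zero h

theorem isConn_units {x : BinVec 10} (h : x ∈ units) : IsConn x := by
  have : ∀ x ∈ units, IsConn x := by decide +kernel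
  exact this x h

/-- Here s and t belong to different coordinates. A second decomposition of s + t would give a
nonzero codeword of weight at most 4. -/
theorem eq_or_eq_of_isConn_add {s t u : BinVec 10} (hs : IsConn s) (ht : IsConn t) (hu : IsConn u)
    (hst : s ≠ t) (h1 : ¬ IsConn (s + t)) (h2 : IsConn (u + (s + t))) : u = s ∨ u = t := by
  have key : ∀ s ∈ connList, ∀ t ∈ connList, s ≠ t → inConn (s ^^^ t) = false →
    ∀ u ∈ connList, inConn (u ^^^ (s ^^^ t)) = true → u = s ∨ u = t := by decide +kernel
  rw [isConn_iff_mem] at hs ht hu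
  rw [IsConn, Bool.not_eq_true, toNat_add] at h1
  rw [IsConn, toNat_add, toNat_add] at h2
  exact (key _ hs _ ht (toNat_injective.ne hst) h1 _ hu h2).imp
    (fun h => toNat_injective h) (fun h => toNat_injective h)

/-- Without codewords of weight 3, adjacency forces p, q, r into one coordinate, which has only
three nonzero symbols. -/
theorem eq_add_of_isConn {p q r : BinVec 10} (hp : IsConn p) (hq : IsConn q) (hr : IsConn r)
    (hpq : IsConn (p + q)) (hpr : IsConn (p + r)) (hqr : IsConn (q + r)) : r = p + q := by
  have key : ∀ p ∈ connList, ∀ q ∈ connList, inConn (p ^^^ q) = true →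
    ∀ r ∈ connList, inConn (p ^^^ r) = true → inConn (q ^^^ r) = true → r = p ^^^ q := by
      decide +kernel
  rw [isConn_iff_mem] at hp hq hr
  rw [IsConn, toNat_add] at hpq hpr hqr
  exact toNat_injective ((key _ hp _ hq hpq _ hr hpr hqr).trans (toNat_add p q).symm)

/-! ### Automorphisms are affine -/

/-- The Cayley graph on the binary vectors of length 10 that models the coset graph. -/
def syndromeGraph : SimpleGraph (BinVec 10) where
  Adj a b := IsConn (a + b)
  symm := ⟨fun a b h => by rwa [add_comm]⟩
  loopless := ⟨fun a h => h.ne_zero (add_self a)⟩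

namespace syndromeGraph

theorem isConn_map_add (g : syndromeGraph ≃g syndromeGraph) (x y : BinVec 10) :
    IsConn (g x + g y) ↔ IsConn (x + y) := g.map_rel_iff

/-- The four points x, x + s, x + t, x + s + t form a 4-cycle. If s + t is in the connection set
they are a clique, and so is the image, which is then a coset of a subgroup of order 4. Otherwise
the fourth image is a common neighbour of two nonadjacent vertices, which have just two common
neighbours; injectivity excludes the wrong one. -/
theorem map_add_add (g : syndromeGraph ≃g syndromeGraph) (x : BinVec 10) {s t : BinVec 10}
    (hs : IsConn s) (ht : IsConn t) : g (x + s + t) + g (x + s) = g (x + t) + g x := by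
  have e1 : ∀ a b c : BinVec 10, (a + c) + (b + c) = a + b := fun a b c => by
    rw [add_add_add_comm, add_self, add_zero]
  have hp : IsConn (g (x + s) + g x) := by
    rw [isConn_map_add, add_comm x, add_assoc, add_self, add_zero]; exact hs
  have hq : IsConn (g (x + t) + g x) := by
    rw [isConn_map_add, add_comm x, add_assoc, add_self, add_zero]; exact ht
  have hu : IsConn (g (x + s + t) + g (x + s)) := by
    rw [isConn_map_add, add_comm (x + s + t), add_add_cancel]; exact ht
  have hv : IsConn (g (x + s + t) + g (x + t)) := by
    rw [isConn_map_add, add_right_comm x s t, add_comm (x + t + s), add_add_cancel]; exact hs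
  have hpq : IsConn ((g (x + s) + g x) + (g (x + t) + g x)) ↔ IsConn (s + t) := by
    rw [e1, isConn_map_add, add_add_add_comm, add_self, zero_add]
  have huw : (g (x + s + t) + g (x + s)) + ((g (x + s) + g x) + (g (x + t) + g x)) =
      g (x + s + t) + g (x + t) := by
    rw [e1, add_assoc, add_add_cancel]
  by_cases hst : s = t
  · subst hst
    rw [add_assoc x, add_self, add_zero, add_comm]
  by_cases h : IsConn (s + t)
  · have hr : IsConn (g (x + s + t) + g x) := by
      rw [isConn_map_add, add_assoc x, add_comm x, add_assoc, add_self, add_zero]; exact h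
    have := eq_add_of_isConn hp hq hr (hpq.2 h) (by rw [e1, add_comm]; exact hu)
      (by rw [e1, add_comm]; exact hv)
    rw [add_add_add_comm, add_self, add_zero] at this
    have h3 : g (x + s + t) = g (x + s) + g (x + t) + g x := by
      rw [← this, add_assoc (g (x + s + t)), add_self, add_zero]
    rw [h3, add_comm _ (g (x + s)), add_assoc (g (x + s)), add_add_cancel]
  · have hne : g (x + s) + g x ≠ g (x + t) + g x := by
      intro he
      exact hst (add_left_cancel (g.injective (add_right_cancel he)))
    rcases eq_or_eq_of_isConn_add hp hq hu hne (fun h' => h (hpq.1 h')) (by rwa [huw]) with he | he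
    · rw [add_comm (g (x + s)) (g x)] at he
      have := g.injective (add_right_cancel he)
      rw [add_assoc] at this
      exact absurd (add_eq_zero_iff.1 (left_eq_add.1 this.symm)) hst
    · exact he

theorem closure_isConn : AddSubgroup.closure {s : BinVec 10 | IsConn s} = ⊤ := by
  rw [eq_top_iff]
  intro x _
  rw [← binComb_units x]
  have hu : ∀ u ∈ units, u ∈ AddSubgroup.closure {s : BinVec 10 | IsConn s} :=
    fun u hu => AddSubgroup.subset_closure (isConn_units hu)
  generalize units = l at hu
  generalize x.toNat = k
  induction l generalizing k with
  | nil => exact zero_mem _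
  | cons a t ih =>
    rw [binComb]
    refine add_mem ?_ (ih (fun u h => hu u (List.mem_cons_of_mem _ h)) _)
    split_ifs
    · exact hu a List.mem_cons_self
    · exact zero_mem _

/-- Induction along the edges of the syndrome graph. -/
theorem induction_isConn {p : BinVec 10 → Prop} (h0 : p 0)
    (hadd : ∀ x s, IsConn s → p x → p (x + s)) (x : BinVec 10) : p x := by
  have hx : x ∈ AddSubgroup.closure {s : BinVec 10 | IsConn s} := by
    rw [closure_isConn]; trivial
  induction hx using AddSubgroup.closure_induction_right with
  | zero => exact h0
  | add_right x _ y hy ih => exact hadd _ _ hy ih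
  | add_neg_cancel x _ y hy ih => exact hadd _ _ hy ih

/-- Every automorphism of the syndrome graph is affine. -/
theorem map_add_eq (g : syndromeGraph ≃g syndromeGraph) (x y : BinVec 10) :
    g (x + y) = g x + g y + g 0 := by
  -- The increment of `g` in direction `t` is unchanged when the base point moves along an edge, and
  -- the graph is connected.
  have h1 : ∀ x t, IsConn t → g (x + t) + g x = g t + g 0 := by
    intro x t ht
    induction x using induction_isConn with
    | h0 => rw [zero_add]
    | hadd x s hs ih => rw [map_add_add g x hs ht, ih]
  induction y using induction_isConn with
  | h0 => rw [add_zero, add_assoc, add_self, add_zero]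
  | hadd y s hs ih =>
    have h2 := add_eq_iff.1 ((add_comm _ _).trans (h1 (x + y) s hs))
    have h3 := add_eq_iff.1 ((add_comm _ _).trans (h1 y s hs))
    rw [← add_assoc, h2, h3, ih]
    abel

end syndromeGraph

/-! ### Tables of linear maps and generators of the stabilizer -/

/-- The exclusive or of the numbers in the list that are selected by the binary digits of `m`. -/
def xorComb : List ℕ → ℕ → ℕ
  | [], _ => 0
  | a :: t, m => Nat.xor (Nat.mul (Nat.mod m 2) a) (xorComb t (Nat.div m 2))

theorem BinVec.toNat_binComb {n : ℕ} (l : List (BinVec n)) (m : ℕ) :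
    (binComb l m).toNat = xorComb (l.map toNat) m := by
  induction l generalizing m with
  | nil => exact toNat_zero
  | cons a t ih =>
    rw [binComb, toNat_add, ih]
    change _ = (m % 2 * a.toNat) ^^^ xorComb (t.map toNat) (m / 2)
    congr 1
    rcases Nat.mod_two_eq_zero_or_one m with h | h <;> simp [h, toNat_zero]

/-- The table of the composition of the linear maps with tables `T` and `U`. -/
def mulTable (T U : List (BinVec 10)) : List (BinVec 10) := U.map fun u => binComb T u.toNat

/-- The table of a power of the linear map with table `T`. -/
def powTable (T : List (BinVec 10)) : ℕ → List (BinVec 10)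
  | 0 => units
  | k + 1 => mulTable (powTable T k) T

theorem endo_apply (T : List (BinVec 10)) (x : BinVec 10) : endo T x = binComb T x.toNat := rfl

theorem endo_mulTable (T U : List (BinVec 10)) (x : BinVec 10) :
    endo (mulTable T U) x = endo T (endo U x) := by
  rw [endo_apply U, map_binComb]
  rfl

theorem endo_units (x : BinVec 10) : endo units x = x := binComb_units x

theorem endo_eq_id_of_mulTable {T U : List (BinVec 10)} (h : mulTable T U = units)
    (x : BinVec 10) : endo T (endo U x) = x := by
  rw [← endo_mulTable, h, endo_units]

/-- `T` and `U` are the tables of mutually inverse linear maps that preserve the connection set. -/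
structure IsConnPair (T U : List (BinVec 10)) : Prop where
  left_inv : mulTable U T = units
  right_inv : mulTable T U = units
  isConn_left : ∀ s ∈ connList, inConn (xorComb (T.map toNat) s) = true
  isConn_right : ∀ s ∈ connList, inConn (xorComb (U.map toNat) s) = true

instance (T U : List (BinVec 10)) : Decidable (IsConnPair T U) :=
  decidable_of_iff (mulTable U T = units ∧ mulTable T U = units ∧
    (∀ s ∈ connList, inConn (xorComb (T.map toNat) s) = true) ∧
    (∀ s ∈ connList, inConn (xorComb (U.map toNat) s) = true))
    ⟨fun h => ⟨h.1, h.2.1, h.2.2.1, h.2.2.2⟩, fun h => ⟨h.1, h.2, h.3, h.4⟩⟩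

theorem isConn_endo_of_forall {T : List (BinVec 10)}
    (h : ∀ s ∈ connList, inConn (xorComb (T.map toNat) s) = true) {x : BinVec 10} (hx : IsConn x) :
    IsConn (endo T x) := by
  rw [IsConn, endo_apply, toNat_binComb]
  exact h _ ((isConn_iff_mem x).1 hx)

namespace syndromeGraph

/-- The linear automorphism of the syndrome graph with a given table. -/
def linearIso {T U : List (BinVec 10)} (h : IsConnPair T U) : syndromeGraph ≃g syndromeGraph where
  toFun := endo T
  invFun := endo U
  left_inv := endo_eq_id_of_mulTable h.left_inv
  right_inv := endo_eq_id_of_mulTable h.right_inv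
  map_rel_iff' {a b} := by
    change IsConn (endo T a + endo T b) ↔ IsConn (a + b)
    rw [← map_add]
    refine ⟨fun hx => ?_, isConn_endo_of_forall h.isConn_left⟩
    rw [← endo_eq_id_of_mulTable h.left_inv (a + b)]
    exact isConn_endo_of_forall h.isConn_right hx

/-- Translation as an automorphism of the syndrome graph. -/
def translation (v : BinVec 10) : syndromeGraph ≃g syndromeGraph where
  toEquiv := Equiv.addRight v
  map_rel_iff' {a b} := by
    change IsConn (a + v + (b + v)) ↔ IsConn (a + b)
    rw [add_add_add_comm, add_self, add_zero]

@[simp] theorem translation_apply (v x : BinVec 10) : translation v x = x + v := rfl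

/-- Table of an automorphism of order 9. -/
def tableA : List (BinVec 10) := [8, 12, 809, 543, 2, 3, 128, 192, 755, 48].map ofNat

/-- Table of an automorphism of order 3. -/
def tableB : List (BinVec 10) := [2, 3, 755, 412, 882, 117, 192, 64, 471, 12].map ofNat

/-- Table of an automorphism of order 2. -/
def tableC : List (BinVec 10) := [1, 2, 32, 48, 12, 4, 730, 187, 928, 543].map ofNat

theorem isConnPair_tableA : IsConnPair tableA (powTable tableA 8) := by decide +kernel

theorem isConnPair_tableB : IsConnPair tableB (powTable tableB 2) := by decide +kernel

theorem isConnPair_tableC : IsConnPair tableC tableC := by decide +kernel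

/-- An automorphism of order 9. -/
def isoA : syndromeGraph ≃g syndromeGraph := linearIso isConnPair_tableA

/-- An automorphism of order 3. -/
def isoB : syndromeGraph ≃g syndromeGraph := linearIso isConnPair_tableB

/-- An automorphism of order 2. -/
def isoC : syndromeGraph ≃g syndromeGraph := linearIso isConnPair_tableC

/-- The elements of the stabilizer of the zero vector. -/
def stabIso (i j k : ℕ) : syndromeGraph ≃g syndromeGraph := isoA ^ i * isoB ^ j * isoC ^ k

/-- The table of `stabIso i j k`. -/
def stabTable (i j k : ℕ) : List (BinVec 10) :=
  mulTable (mulTable (powTable tableA i) (powTable tableB j)) (powTable tableC k)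

theorem linearIso_pow_apply {T U : List (BinVec 10)} (h : IsConnPair T U) (k : ℕ) (x : BinVec 10) :
    (linearIso h ^ k) x = endo (powTable T k) x := by
  induction k generalizing x with
  | zero => exact (endo_units x).symm
  | succ k ih => rw [pow_succ, RelIso.mul_apply, ih, powTable, endo_mulTable]; rfl

theorem stabIso_apply (i j k : ℕ) (x : BinVec 10) :
    stabIso i j k x = endo (stabTable i j k) x := by
  rw [stabTable, endo_mulTable, endo_mulTable, stabIso, RelIso.mul_apply, RelIso.mul_apply, isoA,
    isoB, isoC, linearIso_pow_apply, linearIso_pow_apply, linearIso_pow_apply]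

theorem stabIso_zero (i j k : ℕ) : stabIso i j k 0 = 0 := by rw [stabIso_apply, map_zero]

/-! ### Exhaustive search for the stabilizer of zero -/

/-- The exponent triples that describe the stabilizer. -/
def stabIndices : List (ℕ × ℕ × ℕ) :=
  (List.range 9).flatMap fun i => (List.range 3).flatMap fun j => (List.range 2).map fun k =>
    (i, j, k)

/-- Apply `k` to the evaluated list. -/
def withValues : List ℕ → (List ℕ → Bool) → Bool
  | [], k => k []
  | 0 :: l, k => withValues l fun r => k (0 :: r)
  | (n + 1) :: l, k => withValues l fun r => k ((n + 1) :: r)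

/-- The case distinction on each entry does not affect the value; it makes the kernel evaluate the
entries before the continuation uses them repeatedly. -/
theorem withValues_eq (l : List ℕ) (k : List ℕ → Bool) : withValues l k = k l := by
  induction l generalizing k with
  | nil => rfl
  | cons a t ih => cases a <;> rw [withValues, ih]

/-- The elements of the connection set whose sum with the first entry of the list, if there is one,
is in the connection set. -/
def candidates : List ℕ → List ℕ
  | [] => connList
  | y :: _ => connList.filter fun t => inConn (Nat.xor y t)

/-- Backtracking search for the linear maps that preserve the connection set. A level consists of a
vector in the connection set, a list of combinations of the earlier vectors whose sum with it is in
the connection set, and a list of combinations whose sum with it is not. The arguments `bs` and `ts`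
hold the earlier vectors and their images. -/
def searchLevels : List (ℕ × List ℕ × List ℕ) → List ℕ → List ℕ → Bool
  | [], bs, ts => stabIndices.any fun p => (bs.zip ts).all fun q =>
      Nat.beq (binComb (stabTable p.1 p.2.1 p.2.2) q.1).toNat q.2
  | (b, ms, ns) :: rest, bs, ts =>
    withValues (ms.map (xorComb ts)) fun ys => withValues (ns.map (xorComb ts)) fun zs =>
      (candidates ys).all fun t =>
        !(ys.all (fun y => inConn (Nat.xor y t)) && zs.all (fun z => !(inConn (Nat.xor z t)))) ||
          searchLevels rest (bs ++ [b]) (ts ++ [t])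

/-- The levels of a search have the described properties. -/
def validLevels : List (ℕ × List ℕ × List ℕ) → List ℕ → Bool
  | [], _ => true
  | (b, ms, ns) :: rest, bs => Nat.blt b 1024 && inConn b &&
      ms.all (fun m => inConn (xorComb bs m ^^^ b)) &&
      ns.all (fun m => !(inConn (xorComb bs m ^^^ b))) && validLevels rest (bs ++ [b])

theorem toNat_map_binComb (f : BinVec 10 →+ BinVec 10) (bs : List (BinVec 10)) (m : ℕ) :
    xorComb ((bs.map f).map toNat) m = (f (binComb bs m)).toNat := by
  rw [map_binComb, toNat_binComb]

/-- Soundness of the search: the images under `f` form a branch that no test prunes, so its leaf is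
reached, and there some `stabIso` agrees with `f` on all vectors of the levels. -/
theorem exists_of_searchLevels {f : BinVec 10 →+ BinVec 10} (hf : ∀ x, IsConn (f x) ↔ IsConn x)
    (ls : List (ℕ × List ℕ × List ℕ)) (bs : List (BinVec 10))
    (hv : validLevels ls (bs.map toNat) = true)
    (hs : searchLevels ls (bs.map toNat) ((bs.map f).map toNat) = true) :
    ∃ p ∈ stabIndices, ∀ b ∈ bs ++ ls.map (fun l => ofNat l.1),
      stabIso p.1 p.2.1 p.2.2 b = f b := by
  induction ls generalizing bs with
  | nil =>
    simp only [searchLevels, List.any_eq_true, List.all_eq_true] at hs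
    obtain ⟨p, hp, h⟩ := hs
    refine ⟨p, hp, fun b hb => ?_⟩
    rw [List.map_nil, List.append_nil] at hb
    have hz : (b.toNat, (f b).toNat) ∈ (bs.map toNat).zip ((bs.map f).map toNat) := by
      rw [List.map_map, List.zip_map', List.mem_map]
      exact ⟨b, hb, rfl⟩
    have := h _ hz
    rw [stabIso_apply, endo_apply]
    exact toNat_injective (Nat.eq_of_beq_eq_true this)
  | cons l ls ih =>
    obtain ⟨b, ms, ns⟩ := l
    simp only [validLevels, Bool.and_eq_true, List.all_eq_true, Bool.not_eq_true'] at hv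
    obtain ⟨⟨⟨⟨hb, hc⟩, hms⟩, hns⟩, hv⟩ := hv
    have hb' : (ofNat b : BinVec 10).toNat = b := toNat_ofNat_of_lt (by simpa using hb)
    -- The tests at a level only ask whether a combination of earlier vectors plus `b` lies in the
    -- connection set, which `f` preserves.
    have hsum : ∀ m, inConn (xorComb ((bs.map f).map toNat) m ^^^ (f (ofNat b)).toNat) =
        inConn (xorComb (bs.map toNat) m ^^^ b) := by
      intro m
      rw [toNat_map_binComb, ← toNat_add, ← map_add, ← toNat_binComb]
      have := hf (binComb bs m + ofNat b)
      rw [IsConn, IsConn, toNat_add (binComb bs m), hb'] at this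
      exact Bool.eq_iff_iff.2 this
    have hmem : (f (ofNat b)).toNat ∈ connList := by
      rw [← isConn_iff_mem, hf, IsConn, hb']
      exact hc
    have hcand : (f (ofNat b)).toNat ∈ candidates (ms.map (xorComb ((bs.map f).map toNat))) := by
      cases ms with
      | nil => exact hmem
      | cons m ms =>
        refine List.mem_filter.2 ⟨hmem, ?_⟩
        exact (hsum m).trans (hms m List.mem_cons_self)
    simp only [searchLevels, withValues_eq, List.all_eq_true] at hs
    have h := hs _ hcand
    have h1 : ((ms.map (xorComb ((bs.map f).map toNat))).all
        fun y => inConn (Nat.xor y (f (ofNat b)).toNat)) = true := by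
      simp only [List.all_eq_true, List.mem_map, forall_exists_index, and_imp,
        forall_apply_eq_imp_iff₂]
      exact fun m hm => (hsum m).trans (hms m hm)
    have h2 : ((ns.map (xorComb ((bs.map f).map toNat))).all
        fun y => !(inConn (Nat.xor y (f (ofNat b)).toNat))) = true := by
      simp only [List.all_eq_true, List.mem_map, forall_exists_index, and_imp,
        forall_apply_eq_imp_iff₂, Bool.not_eq_true']
      exact fun m hm => (hsum m).trans (hns m hm)
    rw [h1, h2] at h
    obtain ⟨p, hp, hall⟩ := ih (bs ++ [ofNat b]) (by simpa [hb'] using hv) (by simpa [hb'] using h)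
    exact ⟨p, hp, by simpa using hall⟩

/-- The levels of the search for the automorphisms that fix the zero vector. -/
def stabLevels : List (ℕ × List ℕ × List ℕ) :=
  [(512, [], [1]), (412, [], [3, 1, 2]), (48, [7], []), (4, [1], []), (730, [28], []), (256,
   [53, 58], []), (128, [69, 77], []), (1, [35, 99, 158, 248, 252], []), (2, [88, 118, 209,
   211, 246, 256, 338, 366, 409, 441, 454], [])]

/-- No branch survives here: 12 lies in the stabilizer orbit of size 27 and 64 in the one of size 6.
-/
theorem searchLevels_stabLevels_left : searchLevels stabLevels [12] [64] = true := by
  decide +kernel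

theorem searchLevels_stabLevels_right : searchLevels stabLevels [12] [1] = true := by
  decide +kernel

theorem addHom_ext_of_mulTable {bs T : List (BinVec 10)} (h : mulTable bs T = units)
    {f g : BinVec 10 →+ BinVec 10} (hfg : ∀ b ∈ bs, f b = g b) : f = g := by
  refine addHom_ext fun u hu => ?_
  rw [← h] at hu
  obtain ⟨t, -, rfl⟩ := List.mem_map.1 hu
  rw [map_binComb, map_binComb, List.map_congr_left hfg]

/-- The ten vectors of the search form a basis: the second list writes each unit vector as a
combination of them. -/
theorem mulTable_stabLevels :
    mulTable ((ofNat 12) :: stabLevels.map fun l => ofNat l.1)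
      ([256, 512, 16, 17, 197, 205, 630, 128, 64, 2].map ofNat) = units := by
  decide +kernel

/-- The additive map underlying an automorphism that fixes the zero vector. -/
def toAddHom (g : syndromeGraph ≃g syndromeGraph) (h0 : g 0 = 0) : BinVec 10 →+ BinVec 10 where
  toFun := g
  map_zero' := h0
  map_add' x y := by rw [map_add_eq, h0, add_zero]

theorem isConn_map (g : syndromeGraph ≃g syndromeGraph) (h0 : g 0 = 0) (x : BinVec 10) :
    IsConn (g x) ↔ IsConn x := by
  have := isConn_map_add g x 0
  rwa [h0, add_zero, add_zero] at this

theorem exists_stabIso_of_map (g : syndromeGraph ≃g syndromeGraph) (h0 : g 0 = 0)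
    (h : (g (ofNat 12)).toNat = 64 ∨ (g (ofNat 12)).toNat = 1) :
    ∃ p ∈ stabIndices, g = stabIso p.1 p.2.1 p.2.2 := by
  have hs : searchLevels stabLevels ([(ofNat 12 : BinVec 10)].map toNat)
      (([ofNat 12].map (toAddHom g h0)).map toNat) = true := by
    change searchLevels stabLevels [12] [(g (ofNat 12)).toNat] = true
    rcases h with h | h <;> rw [h]
    · exact searchLevels_stabLevels_left
    · exact searchLevels_stabLevels_right
  obtain ⟨p, hp, hall⟩ := exists_of_searchLevels (f := toAddHom g h0) (isConn_map g h0) stabLevels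
    [ofNat 12] (by decide +kernel) hs
  refine ⟨p, hp, RelIso.ext fun x => ?_⟩
  have := addHom_ext_of_mulTable mulTable_stabLevels (f := toAddHom g h0)
    (g := toAddHom (stabIso p.1 p.2.1 p.2.2) (stabIso_zero _ _ _)) fun b hb => (hall b hb).symm
  exact DFunLike.congr_fun this x

/-- 64 and 1 represent the two orbits on the connection set. Composing with a known element
normalises the image of 12, so the search needs only two starting points. -/
theorem exists_stabIso_map_eq {x : BinVec 10} (hx : IsConn x) :
    ∃ p ∈ stabIndices, (stabIso p.1 p.2.1 p.2.2 x).toNat = 64 ∨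
      (stabIso p.1 p.2.1 p.2.2 x).toNat = 1 := by
  have key : ∀ s ∈ connList, ∃ p ∈ stabIndices,
      (binComb (stabTable p.1 p.2.1 p.2.2) s).toNat = 64 ∨
      (binComb (stabTable p.1 p.2.1 p.2.2) s).toNat = 1 := by decide +kernel
  simpa only [stabIso_apply, endo_apply] using key _ ((isConn_iff_mem x).1 hx)

end syndromeGraph

/-! ### The abstract group (C₉ ⋊ C₃) ⋊ C₂ -/

/-- The homomorphism from a cyclic group that is determined by an element whose order divides `n`. -/
def cyclicHom {n : ℕ} [NeZero n] {G : Type*} [Group G] (g : G) (hg : g ^ n = 1) :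
    Multiplicative (ZMod n) →* G where
  toFun x := g ^ x.toAdd.val
  map_one' := by simp
  map_mul' x y := by
    rw [toAdd_mul, ZMod.val_add, ← pow_eq_pow_mod _ hg, pow_add]

theorem cyclicHom_apply {n : ℕ} [NeZero n] {G : Type*} [Group G] (g : G) (hg : g ^ n = 1)
    (x : Multiplicative (ZMod n)) : cyclicHom g hg x = g ^ x.toAdd.val := rfl

/-- The compatibility condition of `SemidirectProduct.lift` for a cyclic acting group, reduced to
its generator. -/
theorem cyclicHom_comp_eq_conj {n : ℕ} [NeZero n] {N H : Type*} [Group N] [Group H] (f : N →* H)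
    {σ : MulAut N} (hσ : σ ^ n = 1) {b : H} (hb : b ^ n = 1)
    (h : ∀ x, f (σ x) = b * f x * b⁻¹) (g : Multiplicative (ZMod n)) :
    f.comp (cyclicHom σ hσ g).toMonoidHom =
      (MulAut.conj (cyclicHom b hb g)).toMonoidHom.comp f := by
  have key : ∀ (k : ℕ) (x : N), f ((σ ^ k) x) = b ^ k * f x * (b ^ k)⁻¹ := by
    intro k
    induction k with
    | zero => intro x; simp
    | succ k ih =>
      intro x
      rw [pow_succ, MulAut.mul_apply, ih, h, pow_succ]
      group
  ext x
  exact key _ x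

/-- The automorphism `x ↦ 4 x` of the cyclic group of order 9. -/
def fourthPow : MulAut (Multiplicative (ZMod 9)) where
  toFun x := x ^ 4
  invFun x := x ^ 7
  left_inv := by decide
  right_inv := by decide
  map_mul' x y := mul_pow x y 4

theorem fourthPow_apply (x : Multiplicative (ZMod 9)) : fourthPow x = x ^ 4 := rfl

theorem fourthPow_pow : fourthPow ^ 3 = 1 := by
  ext x
  revert x
  decide

/-- The action of the cyclic group of order 3 on the cyclic group of order 9. -/
def stabAction : Multiplicative (ZMod 3) →* MulAut (Multiplicative (ZMod 9)) :=
  cyclicHom fourthPow fourthPow_pow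

/-- The automorphism of `C₉ ⋊ C₃` that inverts `C₉` and fixes `C₃`. -/
def invLeft : MulAut (Multiplicative (ZMod 9) ⋊[stabAction] Multiplicative (ZMod 3)) :=
  SemidirectProduct.congr (MulEquiv.inv _) (MulEquiv.refl _) fun g => by
    ext x
    simp

theorem invLeft_apply (x : Multiplicative (ZMod 9) ⋊[stabAction] Multiplicative (ZMod 3)) :
    invLeft x = ⟨x.left⁻¹, x.right⟩ := rfl

theorem invLeft_pow : invLeft ^ 2 = 1 := by
  ext x <;> simp [pow_two, invLeft_apply]

/-- The action of the cyclic group of order 2 on `C₉ ⋊ C₃`. -/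
def stabAction' : Multiplicative (ZMod 2) →*
    MulAut (Multiplicative (ZMod 9) ⋊[stabAction] Multiplicative (ZMod 3)) :=
  cyclicHom invLeft invLeft_pow

/-- The abstract stabilizer `(C₉ ⋊ C₃) ⋊ C₂`. -/
abbrev StabGroup : Type :=
  (Multiplicative (ZMod 9) ⋊[stabAction] Multiplicative (ZMod 3)) ⋊[stabAction']
    Multiplicative (ZMod 2)

theorem stabAction_ne_one : stabAction ≠ 1 := by
  intro h
  have : stabAction (.ofAdd 1) (.ofAdd 1) = .ofAdd 1 := by rw [h]; rfl
  revert this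
  decide

theorem stabAction'_ne_one : stabAction' ≠ 1 := by
  intro h
  have : (stabAction' (.ofAdd 1) (.inl (.ofAdd 1))).left = .ofAdd 1 := by rw [h]; rfl
  revert this
  decide

theorem card_stabGroup : Nat.card StabGroup = 54 := by
  rw [SemidirectProduct.card, SemidirectProduct.card]
  simp

/-! ### The stabilizer of zero and the order of the automorphism group -/

namespace syndromeGraph

/-- The automorphism `g` is linear with table `T`. -/
def HasTable (g : syndromeGraph ≃g syndromeGraph) (T : List (BinVec 10)) : Prop :=
  ∀ x, g x = endo T x

theorem HasTable.mul {g h : syndromeGraph ≃g syndromeGraph} {T U : List (BinVec 10)}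
    (hg : HasTable g T) (hh : HasTable h U) : HasTable (g * h) (mulTable T U) := fun x => by
  rw [RelIso.mul_apply, hg, hh, endo_mulTable]

theorem hasTable_one : HasTable 1 units := fun x => (endo_units x).symm

theorem HasTable.pow {g : syndromeGraph ≃g syndromeGraph} {T : List (BinVec 10)}
    (hg : HasTable g T) (k : ℕ) : HasTable (g ^ k) (powTable T k) := by
  induction k with
  | zero => exact hasTable_one
  | succ k ih => rw [pow_succ]; exact ih.mul hg

theorem HasTable.eq {g h : syndromeGraph ≃g syndromeGraph} {T U : List (BinVec 10)}
    (hg : HasTable g T) (hh : HasTable h U) (e : T = U) : g = h :=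
  RelIso.ext fun x => by rw [hg, hh, e]

theorem hasTable_isoA : HasTable isoA tableA := fun _ => rfl

theorem hasTable_isoB : HasTable isoB tableB := fun _ => rfl

theorem hasTable_isoC : HasTable isoC tableC := fun _ => rfl

theorem hasTable_stabIso (i j k : ℕ) : HasTable (stabIso i j k) (stabTable i j k) :=
  stabIso_apply i j k

theorem isoA_pow : isoA ^ 9 = 1 := (hasTable_isoA.pow 9).eq hasTable_one (by decide +kernel)

theorem isoB_pow : isoB ^ 3 = 1 := (hasTable_isoB.pow 3).eq hasTable_one (by decide +kernel)

theorem isoC_pow : isoC ^ 2 = 1 := (hasTable_isoC.pow 2).eq hasTable_one (by decide +kernel)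

theorem isoB_mul_isoA : isoB * isoA = isoA ^ 4 * isoB :=
  (hasTable_isoB.mul hasTable_isoA).eq ((hasTable_isoA.pow 4).mul hasTable_isoB) (by decide +kernel)

theorem isoA_mul_isoC_mul_isoA : isoA * isoC * isoA = isoC :=
  ((hasTable_isoA.mul hasTable_isoC).mul hasTable_isoA).eq hasTable_isoC (by decide +kernel)

theorem isoC_mul_isoB : isoC * isoB = isoB * isoC :=
  (hasTable_isoC.mul hasTable_isoB).eq (hasTable_isoB.mul hasTable_isoC) (by decide +kernel)

theorem isoB_conj_isoA (k : ℕ) : isoB * isoA ^ k * isoB⁻¹ = (isoA ^ k) ^ 4 := by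
  have h : isoB * isoA * isoB⁻¹ = isoA ^ 4 := by rw [isoB_mul_isoA, mul_inv_cancel_right]
  rw [← conj_pow, h, ← pow_mul, ← pow_mul, mul_comm]

theorem isoC_conj_isoA (k : ℕ) : isoC * isoA ^ k * isoC⁻¹ = (isoA ^ k)⁻¹ := by
  have h : isoC * isoA * isoC⁻¹ = isoA⁻¹ := by
    rw [mul_inv_eq_iff_eq_mul, eq_inv_mul_iff_mul_eq, ← mul_assoc, isoA_mul_isoC_mul_isoA]
  rw [← conj_pow, h, inv_pow]

/-- The homomorphism from `C₉ ⋊ C₃` to the automorphism group. -/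
def oddStabHom : Multiplicative (ZMod 9) ⋊[stabAction] Multiplicative (ZMod 3) →*
    (syndromeGraph ≃g syndromeGraph) :=
  SemidirectProduct.lift (cyclicHom isoA isoA_pow) (cyclicHom isoB isoB_pow)
    (cyclicHom_comp_eq_conj _ _ _ fun x => by
      rw [fourthPow_apply, map_pow, cyclicHom_apply, isoB_conj_isoA])

theorem oddStabHom_apply (x : Multiplicative (ZMod 9) ⋊[stabAction] Multiplicative (ZMod 3)) :
    oddStabHom x = isoA ^ x.left.toAdd.val * isoB ^ x.right.toAdd.val := rfl

theorem oddStabHom_invLeft (x : Multiplicative (ZMod 9) ⋊[stabAction] Multiplicative (ZMod 3)) :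
    oddStabHom (invLeft x) = isoC * oddStabHom x * isoC⁻¹ := by
  have h1 : oddStabHom (invLeft x) =
      cyclicHom isoA isoA_pow x.left⁻¹ * isoB ^ x.right.toAdd.val := rfl
  have h2 : Commute isoC (isoB ^ x.right.toAdd.val) := Commute.pow_right isoC_mul_isoB _
  rw [h1, oddStabHom_apply, map_inv, cyclicHom_apply, ← isoC_conj_isoA]
  simp only [mul_assoc]
  rw [h2.inv_left.eq]

/-- The homomorphism from `(C₉ ⋊ C₃) ⋊ C₂` to the automorphism group. -/
def stabHom : StabGroup →* (syndromeGraph ≃g syndromeGraph) :=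
  SemidirectProduct.lift oddStabHom (cyclicHom isoC isoC_pow)
    (cyclicHom_comp_eq_conj _ _ _ oddStabHom_invLeft)

theorem stabHom_apply (x : StabGroup) : stabHom x =
    stabIso x.left.left.toAdd.val x.left.right.toAdd.val x.right.toAdd.val := rfl

theorem mem_stabIndices {i j k : ℕ} (hi : i < 9) (hj : j < 3) (hk : k < 2) :
    (i, j, k) ∈ stabIndices := by
  simp [stabIndices, hi, hj, Nat.le_of_lt_succ hk]

theorem stabHom_injective : Function.Injective stabHom := by
  rw [injective_iff_map_eq_one]
  intro x hx
  have key : ∀ p ∈ stabIndices,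
      (∀ u ∈ units, endo (stabTable p.1 p.2.1 p.2.2) u = u) → p = (0, 0, 0) := by decide +kernel
  have h := key _ (mem_stabIndices (ZMod.val_lt x.left.left.toAdd)
      (ZMod.val_lt x.left.right.toAdd) (ZMod.val_lt x.right.toAdd)) fun u _ => by
    rw [← stabIso_apply, ← stabHom_apply, hx]
    rfl
  simp only [Prod.mk.injEq, ZMod.val_eq_zero] at h
  ext
  · exact h.1
  · exact h.2.1
  · exact h.2.2

theorem exists_stabHom_eq_stabIso {p : ℕ × ℕ × ℕ} (hp : p ∈ stabIndices) :
    ∃ x, stabHom x = stabIso p.1 p.2.1 p.2.2 := by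
  obtain ⟨i, j, k⟩ := p
  simp only [stabIndices, List.mem_flatMap, List.mem_map, List.mem_range, Prod.mk.injEq] at hp
  obtain ⟨i, hi, j, hj, k, hk, rfl, rfl, rfl⟩ := hp
  refine ⟨⟨⟨.ofAdd (i : ZMod 9), .ofAdd (j : ZMod 3)⟩, .ofAdd (k : ZMod 2)⟩, ?_⟩
  rw [stabHom_apply]
  simp only [toAdd_ofAdd]
  rw [ZMod.val_cast_of_lt hi, ZMod.val_cast_of_lt hj, ZMod.val_cast_of_lt hk]

theorem exists_stabHom_eq (g : syndromeGraph ≃g syndromeGraph) (h0 : g 0 = 0) :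
    ∃ x, stabHom x = g := by
  have h12 : IsConn (g (ofNat 12)) := by
    rw [isConn_map g h0]
    decide +kernel
  obtain ⟨p, hp, h⟩ := exists_stabIso_map_eq h12
  obtain ⟨q, hq, e⟩ := exists_stabIso_of_map (stabIso p.1 p.2.1 p.2.2 * g)
    (by rw [RelIso.mul_apply, h0, stabIso_zero]) h
  obtain ⟨x, hx⟩ := exists_stabHom_eq_stabIso hp
  obtain ⟨y, hy⟩ := exists_stabHom_eq_stabIso hq
  exact ⟨x⁻¹ * y, by rw [map_mul, map_inv, hx, hy, ← e, inv_mul_cancel_left]⟩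

theorem stabHom_zero (x : StabGroup) : stabHom x 0 = 0 := by rw [stabHom_apply, stabIso_zero]

/-- Every automorphism is a translation composed with a linear automorphism. -/
noncomputable def autEquiv : BinVec 10 × StabGroup ≃ (syndromeGraph ≃g syndromeGraph) :=
  Equiv.ofBijective (fun p => translation p.1 * stabHom p.2) (by
    constructor
    · rintro ⟨v, x⟩ ⟨u, y⟩ h
      have hv : v = u := by
        have := DFunLike.congr_fun h 0
        simpa [RelIso.mul_apply, stabHom_zero] using this
      subst hv
      exact Prod.ext rfl (stabHom_injective (mul_left_cancel h))
    · intro g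
      obtain ⟨x, hx⟩ := exists_stabHom_eq (translation (g 0) * g) (by
        rw [RelIso.mul_apply, translation_apply, add_self])
      -- Translations are involutions, so the one that brings `g 0` back to zero is also the
      -- translation part of `g`.
      refine ⟨(g 0, x), ?_⟩
      simp only
      rw [hx, ← mul_assoc]
      ext y
      simp [RelIso.mul_apply, add_assoc, add_self])

theorem autEquiv_apply (v : BinVec 10) (x : StabGroup) :
    autEquiv (v, x) = translation v * stabHom x := rfl

theorem card_aut : Nat.card (syndromeGraph ≃g syndromeGraph) = 2 ^ 10 * 54 := by
  rw [← Nat.card_congr autEquiv, Nat.card_prod, card_stabGroup, Nat.card_eq_fintype_card, card_eq]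

theorem isPretransitive :
    MulAction.IsPretransitive (syndromeGraph ≃g syndromeGraph) (BinVec 10) :=
  ⟨fun a b => ⟨translation (a + b), add_add_cancel a b⟩⟩

theorem nonempty_stabilizer_mulEquiv :
    Nonempty (MulAction.stabilizer (syndromeGraph ≃g syndromeGraph) (0 : BinVec 10) ≃*
      StabGroup) := by
  have h : stabHom.range = MulAction.stabilizer (syndromeGraph ≃g syndromeGraph) (0 : BinVec 10) := by
    ext g
    rw [MulAction.mem_stabilizer_iff]
    constructor
    · rintro ⟨x, rfl⟩
      exact stabHom_zero x
    · exact exists_stabHom_eq g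
  exact ⟨((MonoidHom.ofInjective stabHom_injective).trans (MulEquiv.subgroupCongr h)).symm⟩

end syndromeGraph

/-! ### Transport along graph isomorphisms -/

section Transport

variable {V V' W : Type*} {G : SimpleGraph V} {G' : SimpleGraph V'} {H : SimpleGraph W}

/-- An isomorphism of graphs induces an isomorphism of the automorphism groups. -/
def autCongr (e : G ≃g G') : (G ≃g G) ≃* (G' ≃g G') where
  toFun g := (e.symm.trans g).trans e
  invFun g := (e.trans g).trans e.symm
  left_inv g := by ext x; simp
  right_inv g := by ext x; simp
  map_mul' g h := by ext x; simp [RelIso.mul_apply]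

theorem autCongr_apply (e : G ≃g G') (g : G ≃g G) (x : V') :
    autCongr e g x = e (g (e.symm x)) := rfl

theorem autCongr_apply_apply (e : G ≃g G') (g : G ≃g G) (x : V) :
    autCongr e g (e x) = e (g x) := by
  rw [autCongr_apply, RelIso.symm_apply_apply]

theorem autCongr_self (h g : G ≃g G) : autCongr h g = h * g * h⁻¹ := rfl

theorem HasFixedType.of_embedding {g : G ≃g G} {p : ℕ} (hp : orderOf g = p) (f : W → V)
    (hf : Function.Injective f) (hfix : ∀ w, g (f w) = f w) (hrange : ∀ v, g v = v → ∃ w, f w = v)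
    (hadj : ∀ a b, G.Adj (f a) (f b) ↔ H.Adj a b) : HasFixedType G g p H := by
  refine ⟨hp, ⟨RelIso.symm ⟨Equiv.ofBijective (fun w => ⟨f w, hfix w⟩) ⟨?_, ?_⟩, ?_⟩⟩⟩
  · exact fun a b h => hf (congrArg Subtype.val h)
  · rintro ⟨v, hv⟩
    obtain ⟨w, rfl⟩ := hrange v hv
    exact ⟨w, rfl⟩
  · intro a b
    exact hadj a b

theorem HasFixedType.congr (e : G ≃g G') {g : G ≃g G} {p : ℕ} (h : HasFixedType G g p H) :
    HasFixedType G' (autCongr e g) p H := by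
  obtain ⟨hp, ⟨i⟩⟩ := h
  refine .of_embedding ((autCongr e).orderOf_eq g |>.trans hp) (fun w => e (i.symm w).1)
    (fun a b hab => i.symm.injective (Subtype.ext (e.injective hab))) (fun w => ?_)
    (fun v hv => ?_) fun a b => ?_
  · have hw : g (i.symm w).1 = (i.symm w).1 := (i.symm w).2
    rw [autCongr_apply_apply, hw]
  · have hv' : g (e.symm v) = e.symm v := by
      rw [autCongr_apply] at hv
      rw [← e.symm_apply_apply (g (e.symm v)), hv]
    exact ⟨i ⟨e.symm v, hv'⟩, by simp⟩
  · rw [e.map_adj_iff, ← i.symm.map_adj_iff]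
    rfl

theorem hasFixedType_one (G : SimpleGraph V) : HasFixedType G 1 1 G :=
  .of_embedding orderOf_one id Function.injective_id (fun _ => rfl) (fun v _ => ⟨v, rfl⟩)
    fun _ _ => Iff.rfl

theorem hasFixedType_of_forall_ne {g : G ≃g G} (h : ∀ v, g v ≠ v) :
    HasFixedType G g (orderOf g) (⊥ : SimpleGraph (Fin 0)) :=
  .of_embedding rfl (fun w => w.elim0) (fun w => w.elim0) (fun w => w.elim0)
    (fun v hv => absurd hv (h v)) fun w => w.elim0

/-- One of the eight possibilities for the order of an automorphism and its fixed subgraph. -/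
def HasListedFixedType (G : SimpleGraph V) (g : G ≃g G) : Prop :=
  HasFixedType G g 1 G ∨
  (∃ p ∈ ({2, 4, 6, 12, 18} : Set ℕ), HasFixedType G g p (⊥ : SimpleGraph (Fin 0))) ∨
  HasFixedType G g 2 (disjointCompletes 8 4) ∨
  HasFixedType G g 3 (⊥ : SimpleGraph (Fin 4)) ∨
  HasFixedType G g 3 (hammingGraph 2 4) ∨
  HasFixedType G g 6 (⊥ : SimpleGraph (Fin 2)) ∨
  HasFixedType G g 9 (⊥ : SimpleGraph (Fin 1)) ∨
  HasFixedType G g 9 (⊤ : SimpleGraph (Fin 4))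

theorem HasListedFixedType.congr (e : G ≃g G') {g : G ≃g G} (h : HasListedFixedType G g) :
    HasListedFixedType G' (autCongr e g) := by
  refine h.imp (fun h => ?_) (.imp (fun ⟨p, hp, h⟩ => ⟨p, hp, h.congr e⟩) (.imp (.congr e)
    (.imp (.congr e) (.imp (.congr e) (.imp (.congr e) (.imp (.congr e) (.congr e)))))))
  rw [orderOf_eq_one_iff.1 h.1, map_one]
  exact hasFixedType_one G'

/-- The existence of each of the eight possibilities. -/
def AllFixedTypesOccur (G : SimpleGraph V) : Prop :=
  (∃ g : G ≃g G, HasFixedType G g 1 G) ∧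
  (∀ p ∈ ({2, 4, 6, 12, 18} : Set ℕ),
    ∃ g : G ≃g G, HasFixedType G g p (⊥ : SimpleGraph (Fin 0))) ∧
  (∃ g : G ≃g G, HasFixedType G g 2 (disjointCompletes 8 4)) ∧
  (∃ g : G ≃g G, HasFixedType G g 3 (⊥ : SimpleGraph (Fin 4))) ∧
  (∃ g : G ≃g G, HasFixedType G g 3 (hammingGraph 2 4)) ∧
  (∃ g : G ≃g G, HasFixedType G g 6 (⊥ : SimpleGraph (Fin 2))) ∧
  (∃ g : G ≃g G, HasFixedType G g 9 (⊥ : SimpleGraph (Fin 1))) ∧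
  (∃ g : G ≃g G, HasFixedType G g 9 (⊤ : SimpleGraph (Fin 4)))

theorem AllFixedTypesOccur.congr (e : G ≃g G') (h : AllFixedTypesOccur G) :
    AllFixedTypesOccur G' := by
  obtain ⟨-, h2, ⟨g3, h3⟩, ⟨g4, h4⟩, ⟨g5, h5⟩, ⟨g6, h6⟩, ⟨g7, h7⟩, ⟨g8, h8⟩⟩ := h
  refine ⟨⟨1, hasFixedType_one G'⟩, fun p hp => ?_, ⟨_, h3.congr e⟩, ⟨_, h4.congr e⟩,
    ⟨_, h5.congr e⟩, ⟨_, h6.congr e⟩, ⟨_, h7.congr e⟩, ⟨_, h8.congr e⟩⟩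
  obtain ⟨g, hg⟩ := h2 p hp
  exact ⟨_, hg.congr e⟩

/-- The edges fall into exactly two orbits, of sizes `m` and `n`. -/
def HasTwoEdgeOrbits (G : SimpleGraph V) (m n : ℕ) : Prop :=
  ∃ O₁ O₂ : Set (Sym2 V), {O | ∃ e ∈ G.edgeSet, O = edgeOrbit G e} = {O₁, O₂} ∧
    O₁.ncard = m ∧ O₂.ncard = n

theorem edgeOrbit_map (e : G ≃g G') (x : Sym2 V) :
    edgeOrbit G' (Sym2.map e x) = Sym2.map e '' edgeOrbit G x := by
  ext y
  simp only [edgeOrbit, Set.mem_ofPred_eq, Set.mem_image]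
  constructor
  · rintro ⟨g, rfl⟩
    refine ⟨_, ⟨(autCongr e).symm g, rfl⟩, ?_⟩
    rw [Sym2.map_map, Sym2.map_map]
    congr 1
    ext v
    simp [autCongr]
  · rintro ⟨_, ⟨g, rfl⟩, rfl⟩
    refine ⟨autCongr e g, ?_⟩
    rw [Sym2.map_map, Sym2.map_map]
    congr 1
    ext v
    simp [autCongr]

theorem HasTwoEdgeOrbits.congr (e : G ≃g G') {m n : ℕ} (h : HasTwoEdgeOrbits G m n) :
    HasTwoEdgeOrbits G' m n := by
  obtain ⟨O₁, O₂, h, h1, h2⟩ := h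
  have hinj : Function.Injective (Sym2.map e) := Sym2.map.injective e.injective
  refine ⟨Sym2.map e '' O₁, Sym2.map e '' O₂, ?_, by rw [Set.ncard_image_of_injective _ hinj, h1],
    by rw [Set.ncard_image_of_injective _ hinj, h2]⟩
  rw [← Set.image_pair, ← h]
  ext O
  simp only [Set.mem_ofPred_eq, Set.mem_image]
  constructor
  · rintro ⟨x, hx, rfl⟩
    refine ⟨_, ⟨Sym2.map e.symm x, ?_, rfl⟩, ?_⟩
    · exact (SimpleGraph.Iso.mapEdgeSet e.symm ⟨x, hx⟩).2
    · rw [← edgeOrbit_map, Sym2.map_map]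
      have : (e : V → V') ∘ e.symm = id := by ext v; simp
      rw [this, Sym2.map_id, id]
  · rintro ⟨_, ⟨x, hx, rfl⟩, rfl⟩
    exact ⟨Sym2.map e x, (SimpleGraph.Iso.mapEdgeSet e ⟨x, hx⟩).2, (edgeOrbit_map e x).symm⟩

/-- Isomorphic graphs with corresponding vertices have isomorphic vertex stabilizers. -/
def stabilizerCongr (e : G ≃g G') (v : V) :
    MulAction.stabilizer (G ≃g G) v ≃* MulAction.stabilizer (G' ≃g G') (e v) :=
  ((autCongr e).subgroupMap _).trans (MulEquiv.subgroupCongr (by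
    ext g
    constructor
    · rintro ⟨g, hg, rfl⟩
      exact (autCongr_apply_apply e g v).trans (congrArg e hg)
    · intro hg
      refine ⟨(autCongr e).symm g, ?_, (autCongr e).apply_symm_apply g⟩
      change e.symm (g (e v)) = v
      exact (RelIso.symm_apply_eq e).2 hg))

end Transport

/-! ### Orders and fixed subgraphs -/

namespace syndromeGraph

theorem eq_two_or_three_of_dvd {p n : ℕ} (hp : p.Prime) (hn : n ∣ 36) (h : p ∣ n) :
    p = 2 ∨ p = 3 := by
  have h36 : p ∣ 2 ^ 2 * 3 ^ 2 := h.trans hn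
  rcases hp.dvd_mul.1 h36 with h | h
  · exact Or.inl ((Nat.prime_dvd_prime_iff_eq hp Nat.prime_two).1 (hp.dvd_of_dvd_pow h))
  · exact Or.inr ((Nat.prime_dvd_prime_iff_eq hp Nat.prime_three).1 (hp.dvd_of_dvd_pow h))

/-- The linear map with table `T` is not the identity. -/
def IsNontrivialTable (T : List (BinVec 10)) : Prop := ∃ u ∈ units, endo T u ≠ u

instance : DecidablePred IsNontrivialTable := fun T =>
  inferInstanceAs (Decidable (∃ u ∈ units, endo T u ≠ u))

/-- All orders needed divide 36, so minimality has to be tested only at the primes 2 and 3. -/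
theorem HasTable.orderOf_eq {g : syndromeGraph ≃g syndromeGraph} {T : List (BinVec 10)}
    (hg : HasTable g T) {n : ℕ} (hn : n ∣ 36) (h1 : powTable T n = units)
    (h2 : 2 ∣ n → IsNontrivialTable (powTable T (n / 2)))
    (h3 : 3 ∣ n → IsNontrivialTable (powTable T (n / 3))) : orderOf g = n := by
  refine orderOf_eq_of_pow_and_pow_div_prime (Nat.pos_of_dvd_of_pos hn (by norm_num))
    ((hg.pow n).eq hasTable_one h1) fun p hp hpn he => ?_
  have : IsNontrivialTable (powTable T (n / p)) := by
    rcases eq_two_or_three_of_dvd hp hn hpn with rfl | rfl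
    exacts [h2 hpn, h3 hpn]
  obtain ⟨u, -, hu⟩ := this
  apply hu
  rw [← hg.pow, he]
  rfl

theorem hasFixedType_stabIso {W : Type*} [Fintype W] {H : SimpleGraph W} {n i j k : ℕ}
    (hp : orderOf (stabIso i j k) = n) (f : W → BinVec 10) (hf : Function.Injective f)
    (hfix : ∀ w, endo (stabTable i j k) (f w) = f w)
    (hrange : (List.range (2 ^ 10)).all (fun m =>
      decide (endo (stabTable i j k) (ofNat m) = ofNat m → ∃ w, f w = ofNat m)) = true)
    (hadj : ∀ a b, IsConn (f a + f b) ↔ H.Adj a b) :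
    HasFixedType syndromeGraph (stabIso i j k) n H := by
  refine .of_embedding hp f hf (fun w => by rw [stabIso_apply, hfix]) (fun v hv => ?_) hadj
  have h := forall_of_all
    (p := fun v => decide (endo (stabTable i j k) v = v → ∃ w, f w = v)) hrange v
  exact of_decide_eq_true h (by rw [← stabIso_apply, hv])

theorem orderOf_stabIso_001 : orderOf (stabIso 0 0 1) = 2 :=
  (hasTable_stabIso 0 0 1).orderOf_eq (by decide) (by decide +kernel) (by decide +kernel)
    (by decide +kernel)

theorem orderOf_stabIso_010 : orderOf (stabIso 0 1 0) = 3 :=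
  (hasTable_stabIso 0 1 0).orderOf_eq (by decide) (by decide +kernel) (by decide +kernel)
    (by decide +kernel)

theorem orderOf_stabIso_020 : orderOf (stabIso 0 2 0) = 3 :=
  (hasTable_stabIso 0 2 0).orderOf_eq (by decide) (by decide +kernel) (by decide +kernel)
    (by decide +kernel)

theorem orderOf_stabIso_011 : orderOf (stabIso 0 1 1) = 6 :=
  (hasTable_stabIso 0 1 1).orderOf_eq (by decide) (by decide +kernel) (by decide +kernel)
    (by decide +kernel)

theorem orderOf_stabIso_021 : orderOf (stabIso 0 2 1) = 6 :=
  (hasTable_stabIso 0 2 1).orderOf_eq (by decide) (by decide +kernel) (by decide +kernel)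
    (by decide +kernel)

theorem orderOf_stabIso_100 : orderOf (stabIso 1 0 0) = 9 :=
  (hasTable_stabIso 1 0 0).orderOf_eq (by decide) (by decide +kernel) (by decide +kernel)
    (by decide +kernel)

theorem orderOf_stabIso_110 : orderOf (stabIso 1 1 0) = 9 :=
  (hasTable_stabIso 1 1 0).orderOf_eq (by decide) (by decide +kernel) (by decide +kernel)
    (by decide +kernel)

theorem orderOf_stabIso_120 : orderOf (stabIso 1 2 0) = 9 :=
  (hasTable_stabIso 1 2 0).orderOf_eq (by decide) (by decide +kernel) (by decide +kernel)
    (by decide +kernel)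

theorem orderOf_stabIso_300 : orderOf (stabIso 3 0 0) = 3 :=
  (hasTable_stabIso 3 0 0).orderOf_eq (by decide) (by decide +kernel) (by decide +kernel)
    (by decide +kernel)

instance (m k : ℕ) : DecidableRel (disjointCompletes m k).Adj := fun a b =>
  inferInstanceAs (Decidable (a.1 = b.1 ∧ a.2 ≠ b.2))

instance (n q : ℕ) : DecidableRel (hammingGraph n q).Adj := fun a b =>
  inferInstanceAs (Decidable (hammingDist a b = 1))

theorem hasFixedType_001 :
    HasFixedType syndromeGraph (stabIso 0 0 1) 2 (disjointCompletes 8 4) :=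
  hasFixedType_stabIso orderOf_stabIso_001
    -- The fixed space has 32 elements and contains the clique {0, 1, 2, 3}; the listed multiples of
    -- 4 represent its cosets.
    (fun w => ofNat (![0, 28, 36, 56, 644, 664, 672, 700] w.1 + w.2))
    (by decide +kernel) (by decide +kernel) (by decide +kernel) (by decide +kernel)

theorem hasFixedType_010 :
    HasFixedType syndromeGraph (stabIso 0 1 0) 3 (⊥ : SimpleGraph (Fin 4)) :=
  hasFixedType_stabIso orderOf_stabIso_010 (fun w => ofNat (![0, 30, 355, 381] w))
    (by decide +kernel) (by decide +kernel) (by decide +kernel) (by decide +kernel)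

theorem hasFixedType_020 :
    HasFixedType syndromeGraph (stabIso 0 2 0) 3 (⊥ : SimpleGraph (Fin 4)) :=
  hasFixedType_stabIso orderOf_stabIso_020 (fun w => ofNat (![0, 30, 355, 381] w))
    (by decide +kernel) (by decide +kernel) (by decide +kernel) (by decide +kernel)

theorem hasFixedType_011 :
    HasFixedType syndromeGraph (stabIso 0 1 1) 6 (⊥ : SimpleGraph (Fin 2)) :=
  hasFixedType_stabIso orderOf_stabIso_011 (fun w => ofNat (![0, 30] w))
    (by decide +kernel) (by decide +kernel) (by decide +kernel) (by decide +kernel)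

theorem hasFixedType_021 :
    HasFixedType syndromeGraph (stabIso 0 2 1) 6 (⊥ : SimpleGraph (Fin 2)) :=
  hasFixedType_stabIso orderOf_stabIso_021 (fun w => ofNat (![0, 30] w))
    (by decide +kernel) (by decide +kernel) (by decide +kernel) (by decide +kernel)

theorem hasFixedType_100 :
    HasFixedType syndromeGraph (stabIso 1 0 0) 9 (⊥ : SimpleGraph (Fin 1)) :=
  hasFixedType_stabIso orderOf_stabIso_100 (fun _ => 0)
    (by decide +kernel) (by decide +kernel) (by decide +kernel) (by decide +kernel)

theorem hasFixedType_110 :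
    HasFixedType syndromeGraph (stabIso 1 1 0) 9 (⊤ : SimpleGraph (Fin 4)) :=
  hasFixedType_stabIso orderOf_stabIso_110 (fun w => ofNat (![0, 64, 128, 192] w))
    (by decide +kernel) (by decide +kernel) (by decide +kernel) (by decide +kernel)

theorem hasFixedType_120 :
    HasFixedType syndromeGraph (stabIso 1 2 0) 9 (⊤ : SimpleGraph (Fin 4)) :=
  hasFixedType_stabIso orderOf_stabIso_120 (fun w => ofNat (![0, 187, 609, 730] w))
    (by decide +kernel) (by decide +kernel) (by decide +kernel) (by decide +kernel)

theorem hasFixedType_300 :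
    HasFixedType syndromeGraph (stabIso 3 0 0) 3 (hammingGraph 2 4) :=
  hasFixedType_stabIso orderOf_stabIso_300
    -- The fixed space is the sum of the subgroups of two coordinates, those whose symbols make up
    -- the small orbit.
    (fun w => ofNat (![0, 64, 128, 192] (w 0)) + ofNat (![0, 187, 609, 730] (w 1)))
    (by decide +kernel) (by decide +kernel) (by decide +kernel) (by decide +kernel)

/-- Representatives of the conjugacy classes of the stabilizer of the zero vector. -/
def stabReps : List (ℕ × ℕ × ℕ) :=
  [(0, 0, 0), (0, 0, 1), (0, 1, 0), (0, 2, 0), (0, 1, 1), (0, 2, 1), (1, 0, 0), (1, 1, 0),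
    (1, 2, 0), (3, 0, 0)]

/-- The representative of the conjugacy class of an element of the stabilizer. -/
def stabRep : ℕ × ℕ × ℕ → ℕ × ℕ × ℕ
  | (_, j, k + 1) => (0, j, k + 1)
  | (0, j, 0) => (0, j, 0)
  | (i + 1, 0, 0) => if (i + 1) % 3 = 0 then (3, 0, 0) else (1, 0, 0)
  | (i + 1, j + 1, 0) => if (i + 1) % 3 = 0 then (0, j + 1, 0) else (1, j + 1, 0)

/-- Elements of the stabilizer that suffice to conjugate each element to its representative. -/
def stabConjugators : List (ℕ × ℕ × ℕ) :=
  (List.range 9).map (fun i => (i, 0, 0)) ++ [(0, 1, 0), (0, 2, 0), (0, 0, 1), (0, 1, 1), (0, 2, 1)]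

theorem exists_conj_stabRep : ∀ p ∈ stabIndices, stabRep p ∈ stabReps ∧ ∃ q ∈ stabConjugators,
    mulTable (stabTable q.1 q.2.1 q.2.2) (stabTable (stabRep p).1 (stabRep p).2.1 (stabRep p).2.2) =
      mulTable (stabTable p.1 p.2.1 p.2.2) (stabTable q.1 q.2.1 q.2.2) := by
  decide +kernel

/-- A property of automorphisms that is invariant under conjugation holds for all linear
automorphisms if it holds for the representatives of the conjugacy classes. -/
theorem forall_stabHom_of_stabReps {P : (syndromeGraph ≃g syndromeGraph) → Prop}
    (hconj : ∀ h g, P g → P (h * g * h⁻¹)) (hP : ∀ r ∈ stabReps, P (stabIso r.1 r.2.1 r.2.2))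
    (x : StabGroup) : P (stabHom x) := by
  have hx := mem_stabIndices (ZMod.val_lt x.left.left.toAdd) (ZMod.val_lt x.left.right.toAdd)
    (ZMod.val_lt x.right.toAdd)
  rw [stabHom_apply]
  generalize x.left.left.toAdd.val = i at *
  generalize x.left.right.toAdd.val = j at *
  generalize x.right.toAdd.val = k at *
  obtain ⟨hr, q, -, h⟩ := exists_conj_stabRep _ hx
  have he := ((hasTable_stabIso q.1 q.2.1 q.2.2).mul (hasTable_stabIso _ _ _)).eq
    ((hasTable_stabIso i j k).mul (hasTable_stabIso _ _ _)) h
  rw [← mul_inv_eq_of_eq_mul he]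
  exact hconj _ _ (hP _ hr)

theorem hasListedFixedType_stabHom (x : StabGroup) :
    HasListedFixedType syndromeGraph (stabHom x) := by
  refine forall_stabHom_of_stabReps (P := HasListedFixedType syndromeGraph)
    (fun h g hg => hg.congr h) ?_ x
  simp only [stabReps, List.forall_mem_cons, List.not_mem_nil, false_imp_iff, implies_true, and_true]
  refine ⟨.inl (by simpa [stabIso] using hasFixedType_one syndromeGraph),
    .inr (.inr (.inl hasFixedType_001)), .inr (.inr (.inr (.inl hasFixedType_010))),
    .inr (.inr (.inr (.inl hasFixedType_020))),
    .inr (.inr (.inr (.inr (.inr (.inl hasFixedType_011))))),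
    .inr (.inr (.inr (.inr (.inr (.inl hasFixedType_021))))),
    .inr (.inr (.inr (.inr (.inr (.inr (.inl hasFixedType_100)))))),
    .inr (.inr (.inr (.inr (.inr (.inr (.inr hasFixedType_110)))))),
    .inr (.inr (.inr (.inr (.inr (.inr (.inr hasFixedType_120)))))),
    .inr (.inr (.inr (.inr (.inl hasFixedType_300))))⟩

theorem orderOf_stabHom (x : StabGroup) : orderOf (stabHom x) ∈ [1, 2, 3, 6, 9] := by
  refine forall_stabHom_of_stabReps (P := fun g => orderOf g ∈ [1, 2, 3, 6, 9])
    (fun h g hg => ?_) ?_ x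
  · rwa [← autCongr_self, (autCongr h).orderOf_eq]
  · simp only [stabReps, List.forall_mem_cons, List.not_mem_nil, false_imp_iff, implies_true,
      and_true, orderOf_stabIso_001, orderOf_stabIso_010, orderOf_stabIso_020, orderOf_stabIso_011,
      orderOf_stabIso_021, orderOf_stabIso_100, orderOf_stabIso_110, orderOf_stabIso_120,
      orderOf_stabIso_300]
    simp [stabIso]

/-- Powers of an affine map have the powers of its linear part as linear parts. -/
theorem affine_pow_apply (v : BinVec 10) (x : StabGroup) (n : ℕ) (y : BinVec 10) :
    ((translation v * stabHom x) ^ n) y =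
      (stabHom x ^ n) y + ((translation v * stabHom x) ^ n) 0 := by
  induction n generalizing y with
  | zero => simp
  | succ n ih =>
    rw [pow_succ', pow_succ', RelIso.mul_apply, RelIso.mul_apply, RelIso.mul_apply, RelIso.mul_apply,
      RelIso.mul_apply, ih, map_add_eq (stabHom x), stabHom_zero, translation_apply,
      translation_apply]
    abel

/-- Raised to the order of the linear part, the map becomes a translation, whose square is the
identity. -/
theorem orderOf_dvd_two_mul (v : BinVec 10) (x : StabGroup) :
    orderOf (translation v * stabHom x) ∣ 2 * orderOf (stabHom x) := by
  rw [orderOf_dvd_iff_pow_eq_one, mul_comm, pow_mul]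
  ext y
  have h : ∀ y, ((translation v * stabHom x) ^ orderOf (stabHom x)) y =
      y + ((translation v * stabHom x) ^ orderOf (stabHom x)) 0 := by
    intro y
    rw [affine_pow_apply, pow_orderOf_eq_one]
    rfl
  rw [pow_two, RelIso.mul_apply, h, h y, add_assoc, add_self, add_zero]
  rfl

theorem orderOf_stabHom_dvd (v : BinVec 10) (x : StabGroup) :
    orderOf (stabHom x) ∣ orderOf (translation v * stabHom x) := by
  rw [orderOf_dvd_iff_pow_eq_one]
  ext y
  have h := affine_pow_apply v x (orderOf (translation v * stabHom x)) y
  rw [pow_orderOf_eq_one] at h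
  have h' : y = (stabHom x ^ orderOf (translation v * stabHom x)) y + 0 := h
  rw [add_zero] at h'
  exact h'.symm

/-- The number of vertices, 2¹⁰, is not divisible by 3. -/
theorem exists_fixed_of_orderOf {g : syndromeGraph ≃g syndromeGraph} {n : ℕ}
    (hg : orderOf g = 3 ^ n) : ∃ v, g v = v := by
  have h3 : Fact (Nat.Prime 3) := ⟨Nat.prime_three⟩
  refine Equiv.Perm.exists_fixed_point_of_prime (p := 3) (n := n) (σ := g.toEquiv) ?_ ?_
  · rw [card_eq]
    decide
  · have h : ∀ k : ℕ, g.toEquiv ^ k = (g ^ k).toEquiv := by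
      intro k
      induction k with
      | zero => rfl
      | succ k ih => rw [pow_succ, pow_succ, ih]; rfl
    rw [h, ← hg, pow_orderOf_eq_one]
    rfl

/-- The order is m or 2m, with m that of the linear part. The value m is excluded if it is a power
of 3, which forces a fixed vertex, or if the m-th power moves zero. -/
theorem orderOf_eq_two_mul (v : BinVec 10) (x : StabGroup)
    (hne : ∀ y, (translation v * stabHom x) y ≠ y)
    (h : orderOf (stabHom x) = 1 ∨ orderOf (stabHom x) = 3 ∨ orderOf (stabHom x) = 9 ∨
      ((translation v * stabHom x) ^ orderOf (stabHom x)) 0 ≠ 0) :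
    orderOf (translation v * stabHom x) = 2 * orderOf (stabHom x) := by
  obtain ⟨k, hk⟩ := orderOf_stabHom_dvd v x
  have hpos : 0 < orderOf (stabHom x) := by
    have := orderOf_stabHom x
    by_contra h0
    rw [Nat.eq_zero_of_not_pos h0] at this
    revert this
    decide
  have hk2 : k ∣ 2 := by
    have := orderOf_dvd_two_mul v x
    rw [hk, mul_comm 2] at this
    exact Nat.dvd_of_mul_dvd_mul_left hpos this
  rcases (Nat.dvd_prime Nat.prime_two).1 hk2 with rfl | rfl
  · exfalso
    rw [mul_one] at hk
    have hcon : ∀ n, orderOf (stabHom x) = 3 ^ n → False := fun n hn => by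
      obtain ⟨y, hy⟩ := exists_fixed_of_orderOf (hk.trans hn)
      exact hne y hy
    rcases h with h | h | h | h
    · exact hcon 0 h
    · exact hcon 1 h
    · exact hcon 2 h
    · rw [← hk, pow_orderOf_eq_one] at h
      exact h rfl
  · rw [hk, mul_comm]

theorem hasListedFixedType (g : syndromeGraph ≃g syndromeGraph) :
    HasListedFixedType syndromeGraph g := by
  obtain ⟨⟨v, x⟩, rfl⟩ := autEquiv.surjective g
  rw [autEquiv_apply]
  by_cases h : ∃ y, (translation v * stabHom x) y = y
  · obtain ⟨y, hy⟩ := h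
    -- Moving the origin to the fixed vertex `y` makes the affine map linear.
    have hc : autCongr (translation y) (stabHom x) = translation v * stabHom x := by
      ext z
      have h1 : (translation y).symm z = z + y := by
        rw [RelIso.symm_apply_eq, translation_apply, add_assoc, add_self, add_zero]
      rw [RelIso.mul_apply, translation_apply] at hy
      rw [autCongr_apply, h1, map_add_eq, stabHom_zero, add_zero, translation_apply,
        RelIso.mul_apply, translation_apply, add_assoc, add_eq_iff.1 hy]
    rw [← hc]
    exact (hasListedFixedType_stabHom x).congr _
  · push Not at h
    refine .inr (.inl ⟨_, ?_, hasFixedType_of_forall_ne h⟩)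
    have hm := orderOf_stabHom x
    simp only [List.mem_cons, List.not_mem_nil, or_false] at hm
    -- The m-th power is translation by this vector, so the case decides between order m and order
    -- 2m.
    by_cases h0 : ((translation v * stabHom x) ^ orderOf (stabHom x)) 0 = 0
    · have hd : orderOf (translation v * stabHom x) = orderOf (stabHom x) := by
        refine Nat.dvd_antisymm ?_ (orderOf_stabHom_dvd v x)
        rw [orderOf_dvd_iff_pow_eq_one]
        ext y
        rw [affine_pow_apply, h0, pow_orderOf_eq_one, add_zero]
      rcases hm with hm | hm | hm | hm | hm
      · have := orderOf_eq_two_mul v x h (by tauto)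
        omega
      · simp [hd, hm]
      · have := orderOf_eq_two_mul v x h (by tauto)
        omega
      · simp [hd, hm]
      · have := orderOf_eq_two_mul v x h (by tauto)
        omega
    · rw [orderOf_eq_two_mul v x h (by tauto)]
      rcases hm with hm | hm | hm | hm | hm <;> simp [hm]

end syndromeGraph

/-! ### Occurrence of all fixed types -/

namespace syndromeGraph

theorem translation_mul_pow_apply (v : BinVec 10) {g : syndromeGraph ≃g syndromeGraph}
    {T : List (BinVec 10)} (hg : HasTable g T) (n : ℕ) (y : BinVec 10) :
    ((translation v * g) ^ n) y = (fun y => endo T y + v)^[n] y := by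
  induction n generalizing y with
  | zero => rfl
  | succ n ih =>
    rw [pow_succ, RelIso.mul_apply, ih, Function.iterate_succ_apply, RelIso.mul_apply,
      translation_apply, hg]

theorem exists_hasFixedType_bot (v : BinVec 10) {i j k n : ℕ} (hp : (i, j, k) ∈ stabIndices)
    (hn : orderOf (stabIso i j k) = n)
    (hne : (List.range (2 ^ 10)).all
      (fun m => decide (endo (stabTable i j k) (ofNat m) + v ≠ ofNat m)) = true)
    (h : n = 1 ∨ n = 3 ∨ n = 9 ∨ (fun y => endo (stabTable i j k) y + v)^[n] 0 ≠ 0) :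
    ∃ g, HasFixedType syndromeGraph g (2 * n) (⊥ : SimpleGraph (Fin 0)) := by
  obtain ⟨x, hx⟩ := exists_stabHom_eq_stabIso hp
  have hf : ∀ y, (translation v * stabHom x) y ≠ y := fun y => by
    rw [hx, RelIso.mul_apply, translation_apply, stabIso_apply]
    exact of_decide_eq_true
      (forall_of_all (p := fun y => decide (endo (stabTable i j k) y + v ≠ y)) hne y)
  have ho := orderOf_eq_two_mul v x hf (by
    rwa [hx, hn, translation_mul_pow_apply v (hasTable_stabIso i j k)])
  rw [hx, hn] at ho
  rw [hx] at hf
  exact ⟨_, ho ▸ hasFixedType_of_forall_ne hf⟩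

theorem allFixedTypesOccur : AllFixedTypesOccur syndromeGraph := by
  refine ⟨⟨1, hasFixedType_one _⟩, ?_, ⟨_, hasFixedType_001⟩, ⟨_, hasFixedType_010⟩,
    ⟨_, hasFixedType_300⟩, ⟨_, hasFixedType_011⟩, ⟨_, hasFixedType_100⟩, ⟨_, hasFixedType_110⟩⟩
  -- The linear parts have orders 1, 2, 3, 6, 9 and the order doubles each time. The translation
  -- vector lies outside the image of L + 1, where L is the linear part, so that no vertex is fixed;
  -- for orders 4 and 12 it is also chosen such that the power of exponent 2 or 6 moves zero.
  rintro p (rfl | rfl | rfl | rfl | rfl)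
  · exact exists_hasFixedType_bot (ofNat 1) (n := 1) (i := 0) (j := 0) (k := 0) (by decide +kernel)
      (by simp [stabIso]) (by decide +kernel) (by decide)
  · exact exists_hasFixedType_bot (ofNat 4) (by decide +kernel) orderOf_stabIso_001 (by decide +kernel)
      (by decide +kernel)
  · exact exists_hasFixedType_bot (ofNat 4) (by decide +kernel) orderOf_stabIso_010 (by decide +kernel)
      (by decide)
  · exact exists_hasFixedType_bot (ofNat 4) (by decide +kernel) orderOf_stabIso_011 (by decide +kernel)
      (by decide +kernel)
  · exact exists_hasFixedType_bot (ofNat 1) (by decide +kernel) orderOf_stabIso_110 (by decide +kernel)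
      (by decide)

/-! ### Edge orbits -/

/-- The Cayley graph whose connection set is given by a list of numbers. -/
def listGraph (l : List ℕ) (h0 : 0 ∉ l) : SimpleGraph (BinVec 10) where
  Adj a b := (a + b).toNat ∈ l
  symm := ⟨fun a b h => by rwa [add_comm]⟩
  loopless := ⟨fun a h => h0 (by rwa [add_self, toNat_zero] at h)⟩

instance (l : List ℕ) (h0 : 0 ∉ l) : DecidableRel (listGraph l h0).Adj := fun a b =>
  inferInstanceAs (Decidable ((a + b).toNat ∈ l))

theorem degree_listGraph {l : List ℕ} (h0 : 0 ∉ l) (hl : l.Nodup) (hlt : ∀ n ∈ l, n < 2 ^ 10)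
    (v : BinVec 10) : (listGraph l h0).degree v = l.length := by
  rw [← SimpleGraph.card_neighborFinset_eq_degree, ← List.toFinset_card_of_nodup hl]
  refine Finset.card_nbij' (fun b => (v + b).toNat) (fun n => v + ofNat n) ?_ ?_ ?_ ?_
  · intro b hb
    exact Finset.mem_coe.2 (List.mem_toFinset.2 ((SimpleGraph.mem_neighborFinset _ _ _).1 hb))
  · intro n hn
    have hn' : n ∈ l := by simpa using hn
    refine Finset.mem_coe.2 ((SimpleGraph.mem_neighborFinset _ _ _).2 ?_)
    change (v + (v + ofNat n)).toNat ∈ l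
    rwa [add_add_cancel, toNat_ofNat_of_lt (hlt n hn')]
  · intro b _
    simp only
    rw [ofNat_toNat, add_add_cancel]
  · intro n hn
    simp only
    rw [add_add_cancel, toNat_ofNat_of_lt (hlt n (by simpa using hn))]

theorem ncard_edgeSet_listGraph {l : List ℕ} (h0 : 0 ∉ l) (hl : l.Nodup)
    (hlt : ∀ n ∈ l, n < 2 ^ 10) : (listGraph l h0).edgeSet.ncard = 2 ^ 9 * l.length := by
  have h := (listGraph l h0).sum_degrees_eq_twice_card_edges
  simp only [degree_listGraph h0 hl hlt, Finset.sum_const, Finset.card_univ, card_eq,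
    smul_eq_mul] at h
  rw [← SimpleGraph.coe_edgeFinset, Set.ncard_coe_finset]
  omega

/-- Translations preserve the difference of an edge, and edges with equal difference are translates.
A set of differences that is one orbit of the stabilizer thus gives one edge orbit. -/
theorem edgeOrbit_eq_edgeSet {l : List ℕ} (h0 : 0 ∉ l)
    (hmap : ∀ p ∈ stabIndices, ∀ s ∈ l, (endo (stabTable p.1 p.2.1 p.2.2) (ofNat s)).toNat ∈ l)
    {s₀ : BinVec 10} (htrans : ∀ s ∈ l, ∃ p ∈ stabIndices,
      (endo (stabTable p.1 p.2.1 p.2.2) s₀).toNat = s)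
    {e : Sym2 (BinVec 10)} (he : e ∈ (listGraph l h0).edgeSet) :
    edgeOrbit syndromeGraph e = (listGraph l h0).edgeSet := by
  have hlin : ∀ (x : StabGroup) (y z : BinVec 10),
      stabHom x (y + z) = stabHom x y + stabHom x z := fun x y z => by
    rw [map_add_eq, stabHom_zero, add_zero]
  have hex : ∀ c d : BinVec 10, (c + d).toNat ∈ l → ∃ x : StabGroup, stabHom x s₀ = c + d := by
    intro c d h
    obtain ⟨p, hp, hpe⟩ := htrans _ h
    obtain ⟨x, hx⟩ := exists_stabHom_eq_stabIso hp
    exact ⟨x, toNat_injective (by rw [hx, stabIso_apply, hpe])⟩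
  induction e with
  | _ a b =>
  rw [SimpleGraph.mem_edgeSet] at he
  ext f
  induction f with
  | _ c d =>
  constructor
  · rintro ⟨g, hg⟩
    obtain ⟨⟨v, x⟩, rfl⟩ := autEquiv.surjective g
    have hadj : (listGraph l h0).Adj (autEquiv (v, x) a) (autEquiv (v, x) b) := by
      change (_ + _ : BinVec 10).toNat ∈ l
      rw [autEquiv_apply, RelIso.mul_apply, RelIso.mul_apply, translation_apply, translation_apply,
        add_add_add_comm, add_self, add_zero, ← hlin, stabHom_apply, stabIso_apply]
      have h := hmap _ (mem_stabIndices (ZMod.val_lt x.left.left.toAdd)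
        (ZMod.val_lt x.left.right.toAdd) (ZMod.val_lt x.right.toAdd)) _ he
      rwa [ofNat_toNat] at h
    rw [hg]
    exact hadj
  · intro hcd
    obtain ⟨x, hx⟩ := hex _ _ he
    obtain ⟨y, hy⟩ := hex _ _ hcd
    have hz : stabHom (y * x⁻¹) (a + b) = c + d := by
      rw [map_mul, map_inv, RelIso.mul_apply, ← hx, ← hy, RelIso.inv_apply_self]
    -- The linear part matches the differences; the translation then takes the image of `a` to `c`,
    -- and the image of `b` follows.
    refine ⟨translation (c + stabHom (y * x⁻¹) a) * stabHom (y * x⁻¹), ?_⟩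
    rw [Sym2.map_mk, RelIso.mul_apply, RelIso.mul_apply, translation_apply, translation_apply]
    have h1 : stabHom (y * x⁻¹) a + (c + stabHom (y * x⁻¹) a) = c := by
      rw [add_comm c, add_add_cancel]
    have h2 : stabHom (y * x⁻¹) b + (c + stabHom (y * x⁻¹) a) = d := by
      rw [add_comm, add_assoc, ← hlin, hz, add_add_cancel]
    rw [h1, h2]

/-- Connection set of the smaller edge orbit. -/
def smallOrbit : List ℕ := [64, 128, 187, 192, 609, 730]

/-- Connection set of the larger edge orbit. -/
def largeOrbit : List ℕ := connList.filter fun s => s ∉ smallOrbit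

theorem zero_notMem_smallOrbit : 0 ∉ smallOrbit := by decide

theorem zero_notMem_largeOrbit : 0 ∉ largeOrbit := by decide +kernel

theorem edgeOrbit_of_mem_smallOrbit {e : Sym2 (BinVec 10)}
    (he : e ∈ (listGraph smallOrbit zero_notMem_smallOrbit).edgeSet) :
    edgeOrbit syndromeGraph e = (listGraph smallOrbit zero_notMem_smallOrbit).edgeSet :=
  edgeOrbit_eq_edgeSet _ (by decide +kernel) (s₀ := ofNat 64) (by decide +kernel) he

theorem edgeOrbit_of_mem_largeOrbit {e : Sym2 (BinVec 10)}
    (he : e ∈ (listGraph largeOrbit zero_notMem_largeOrbit).edgeSet) :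
    edgeOrbit syndromeGraph e = (listGraph largeOrbit zero_notMem_largeOrbit).edgeSet :=
  edgeOrbit_eq_edgeSet _ (by decide +kernel) (s₀ := ofNat 1) (by decide +kernel) he

theorem mem_edgeSet_iff (e : Sym2 (BinVec 10)) : e ∈ syndromeGraph.edgeSet ↔
    e ∈ (listGraph smallOrbit zero_notMem_smallOrbit).edgeSet ∨
      e ∈ (listGraph largeOrbit zero_notMem_largeOrbit).edgeSet := by
  induction e with
  | _ a b =>
  simp only [SimpleGraph.mem_edgeSet]
  have h : ∀ n, n ∈ connList ↔ n ∈ smallOrbit ∨ n ∈ largeOrbit := by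
    intro n
    have hsub : ∀ n ∈ smallOrbit, n ∈ connList := by decide
    rw [largeOrbit, List.mem_filter, decide_eq_true_iff]
    by_cases hn : n ∈ smallOrbit
    · simp [hn, hsub n hn]
    · simp [hn]
  exact (isConn_iff_mem _).trans (h _)

theorem hasTwoEdgeOrbits : HasTwoEdgeOrbits syndromeGraph (2 ^ 9 * 6) (2 ^ 9 * 27) := by
  refine ⟨(listGraph smallOrbit zero_notMem_smallOrbit).edgeSet,
    (listGraph largeOrbit zero_notMem_largeOrbit).edgeSet, ?_, ?_, ?_⟩
  · ext O
    simp only [mem_edgeSet_iff, Set.mem_ofPred_eq, Set.mem_insert_iff, Set.mem_singleton_iff]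
    constructor
    · rintro ⟨e, he | he, rfl⟩
      · exact .inl (edgeOrbit_of_mem_smallOrbit he)
      · exact .inr (edgeOrbit_of_mem_largeOrbit he)
    · rintro (rfl | rfl)
      · have he : s((0 : BinVec 10), ofNat 64) ∈
            (listGraph smallOrbit zero_notMem_smallOrbit).edgeSet := by
          rw [SimpleGraph.mem_edgeSet]
          decide +kernel
        exact ⟨_, .inl he, (edgeOrbit_of_mem_smallOrbit he).symm⟩
      · have he : s((0 : BinVec 10), ofNat 1) ∈
            (listGraph largeOrbit zero_notMem_largeOrbit).edgeSet := by
          rw [SimpleGraph.mem_edgeSet]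
          decide +kernel
        exact ⟨_, .inr he, (edgeOrbit_of_mem_largeOrbit he).symm⟩
  · rw [ncard_edgeSet_listGraph _ (by decide) (by decide)]
    rfl
  · rw [ncard_edgeSet_listGraph _ (by decide +kernel) (by decide +kernel)]
    rfl

end syndromeGraph

/-! ### A check matrix of the punctured code -/

/-- The columns of a check matrix of the punctured dodecacode: the syndromes of `1` and of `w` at
each coordinate, with zeros at the deleted coordinate. -/
def checkColumns : Fin 12 → List ℕ :=
  ![[0, 0], [1, 2], [4, 8], [16, 32], [64, 128], [215, 256], [394, 512], [809, 543], [187, 609],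
    [494, 590], [879, 755], [117, 775]]

/-- The syndrome of a symbol at a coordinate. -/
def column (m : Fin 12) : BinVec 2 →+ BinVec 10 :=
  linearMap add_self ((checkColumns m).map ofNat)

/-- The generator word of the dodecacode, with the symbol `a + b w` written as the binary vector
with digits `a`, `b`. -/
def binWord (m : Fin 12) : BinVec 2 := ofNat (![2, 1, 0, 1, 0, 0, 1, 0, 0, 1, 0, 1] m)

/-- The symbols of a word with a given syndrome. -/
def sectionTable : Fin 12 → List ℕ :=
  ![[], [1, 2], [0, 0, 1, 2], [0, 0, 0, 0, 1, 2], [0, 0, 0, 0, 0, 0, 1, 2],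
    [0, 0, 0, 0, 0, 0, 0, 0, 2], [0, 0, 0, 0, 0, 0, 0, 0, 0, 2], [], [], [], [], []]

/-- The symbol at a coordinate of a word with a given syndrome. -/
def syndromeSection (m : Fin 12) : BinVec 10 →+ BinVec 2 :=
  linearMap add_self ((sectionTable m).map ofNat)

/-- Combinations of the generators of the dodecacode that agree, outside of coordinate `0`, with the
sum of a symbol and the word with the same syndrome. -/
def codewordMasks : Fin 12 → List ℕ :=
  ![[0, 0], [0, 0], [0, 0], [0, 0], [0, 0], [18, 0], [54, 0], [108, 199], [31, 329], [62, 583],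
    [110, 1115], [9, 2147]]

/-- All cyclic shifts of the generator have syndrome zero. The zero column at coordinate 0 makes the
deleted symbol irrelevant. -/
theorem sum_column_binWord : ∀ r : Fin 12, ∑ m, column m (binWord (m + r)) = 0 := by
  decide +kernel

theorem sum_column_syndromeSection (v : BinVec 10) :
    ∑ m, column m (syndromeSection m v) = v := by
  have h : ∑ m, (column m).comp (syndromeSection m) = AddMonoidHom.id (BinVec 10) := by
    refine addHom_ext fun u hu => ?_
    simp only [AddMonoidHom.finsetSum_apply, AddMonoidHom.comp_apply, AddMonoidHom.id_apply]
    revert u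
    decide +kernel
  simpa using DFunLike.congr_fun h v

/-- Explicit codewords showing that a word of weight one is congruent, modulo the punctured code, to
the chosen word with its syndrome. At coordinates 1 to 4 the two words coincide, hence the zero
masks. -/
theorem symbol_add_section_eq_binComb : ∀ m : Fin 12, m ≠ 0 → ∀ c : Fin 4, ∀ m' : Fin 12, m' ≠ 0 →
    (if m' = m then ofNat c else 0) + syndromeSection m' (column m (ofNat c)) =
      binComb (List.ofFn fun s => binWord (m' - s))
        (xorComb (codewordMasks m) c) := by
  decide +kernel

theorem isConn_column : ∀ m : Fin 12, m ≠ 0 → ∀ c : Fin 4, c ≠ 0 → IsConn (column m (ofNat c)) := by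
  decide +kernel

theorem exists_column_eq {s : BinVec 10} (hs : IsConn s) :
    ∃ m : Fin 12, m ≠ 0 ∧ ∃ c : BinVec 2, c ≠ 0 ∧ column m c = s := by
  have h : ∀ n ∈ connList, ∃ m : Fin 12, m ≠ 0 ∧ ∃ c : Fin 4,
      (ofNat c : BinVec 2) ≠ 0 ∧ (column m (ofNat c)).toNat = n := by decide +kernel
  obtain ⟨m, hm, c, hc, h⟩ := h _ ((isConn_iff_mem s).1 hs)
  exact ⟨m, hm, ofNat c, hc, toNat_injective h⟩

theorem exists_ofNat_eq (c : BinVec 2) : ∃ k : Fin 4, (ofNat k : BinVec 2) = c :=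
  ⟨equivFin 2 c, ofNat_toNat c⟩

/-! ### Identification of the coset graph -/

section Field

variable {F : Type*} [Field F]

theorem add_self_of_card_eq_four (hF : Nat.card F = 4) (a : F) : a + a = 0 := by
  have h4 : (4 : F) = 0 := by
    have : Finite F := Nat.finite_of_card_ne_zero (by omega)
    have := Fintype.ofFinite F
    have h := Nat.cast_card_eq_zero F
    rw [← Nat.card_eq_fintype_card, hF] at h
    exact_mod_cast h
  have h2 : (2 : F) * 2 = 0 := by rw [← h4]; norm_num
  rw [← two_mul, mul_self_eq_zero.1 h2, zero_mul]

/-- The symbol `a + b w` that is described by a binary vector with digits `a`, `b`. -/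
def symbolHom (h2 : ∀ a : F, a + a = 0) (w : F) : BinVec 2 →+ F := linearMap h2 [1, w]

theorem symbolHom_bijective (hF : Nat.card F = 4) {w : F} (hw : w ^ 2 + w + 1 = 0) :
    Function.Bijective (symbolHom (add_self_of_card_eq_four hF) w) := by
  have hfin : Finite F := Nat.finite_of_card_ne_zero (by omega)
  refine Function.Injective.bijective_of_nat_card_le ?_ (by
    simp [hF, Nat.card_eq_fintype_card, card_eq])
  rw [injective_iff_map_eq_zero]
  intro c hc
  obtain ⟨k, rfl⟩ := exists_ofNat_eq c
  have h2 := add_self_of_card_eq_four hF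
  fin_cases k
  · rfl
  · exfalso
    have : (1 : F) + (0 + 0) = 0 := hc
    simp at this
  · exfalso
    have : (0 : F) + (w + 0) = 0 := hc
    simp only [zero_add, add_zero] at this
    simp [this] at hw
  · exfalso
    have : (1 : F) + (w + 0) = 0 := hc
    rw [add_zero, add_comm] at this
    have hz : w ^ 2 = 0 := by rw [← hw, add_assoc, this, add_zero]
    rw [pow_eq_zero_iff two_ne_zero] at hz
    simp [hz] at this

/-- The symbols as binary vectors. -/
noncomputable def symbolEquiv (hF : Nat.card F = 4) {w : F} (hw : w ^ 2 + w + 1 = 0) :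
    BinVec 2 ≃+ F :=
  AddEquiv.ofBijective (symbolHom (add_self_of_card_eq_four hF) w) (symbolHom_bijective hF hw)

theorem symbolEquiv_binWord (hF : Nat.card F = 4) {w : F} (hw : w ^ 2 + w + 1 = 0) (m : Fin 12) :
    symbolEquiv hF hw (binWord m) = dodecaWord w m := by
  have h0 : symbolEquiv hF hw (ofNat 0) = 0 := map_zero _
  have h1 : symbolEquiv hF hw (ofNat 1) = 1 := by
    change (1 : F) + (0 + 0) = 1
    simp
  have h2 : symbolEquiv hF hw (ofNat 2) = w := by
    change (0 : F) + (w + 0) = w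
    simp
  fin_cases m
  exacts [h2, h1, h0, h1, h0, h0, h1, h0, h0, h1, h0, h1]

/-- The syndrome of a word, where coordinate `i` of the dodecacode is deleted. -/
noncomputable def syndrome (ε : BinVec 2 ≃+ F) (i : Fin 12) : (Fin 11 → F) →+ BinVec 10 where
  toFun x := ∑ k, column (i.succAbove k - i) (ε.symm (x k))
  map_zero' := by simp
  map_add' x y := by simp [Finset.sum_add_distrib]

theorem syndrome_apply (ε : BinVec 2 ≃+ F) (i : Fin 12) (x : Fin 11 → F) :
    syndrome ε i x = ∑ k, column (i.succAbove k - i) (ε.symm (x k)) := rfl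

/-- A word with a given syndrome. -/
noncomputable def wordOfSyndrome (ε : BinVec 2 ≃+ F) (i : Fin 12) : BinVec 10 →+ (Fin 11 → F) where
  toFun v k := ε (syndromeSection (i.succAbove k - i) v)
  map_zero' := by ext; simp
  map_add' x y := by ext; simp

theorem wordOfSyndrome_apply (ε : BinVec 2 ≃+ F) (i : Fin 12) (v : BinVec 10) (k : Fin 11) :
    wordOfSyndrome ε i v k = ε (syndromeSection (i.succAbove k - i) v) := rfl

theorem column_zero (c : BinVec 2) : column 0 c = 0 := by
  revert c
  decide +kernel

/-- Coordinates are counted from the deleted one, so a single check matrix serves every `i`; the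
missing term vanishes with column 0. -/
theorem sum_column_succAbove (i : Fin 12) (f : Fin 12 → BinVec 2) :
    ∑ k, column (i.succAbove k - i) (f (i.succAbove k - i)) = ∑ m, column m (f m) := by
  rw [← (Equiv.subRight i).sum_comp, Fin.sum_univ_succAbove _ i]
  simp [column_zero]

theorem syndrome_wordOfSyndrome (ε : BinVec 2 ≃+ F) (i : Fin 12) (v : BinVec 10) :
    syndrome ε i (wordOfSyndrome ε i v) = v := by
  simp only [syndrome_apply, wordOfSyndrome_apply, AddEquiv.symm_apply_apply]
  rw [sum_column_succAbove i fun m => syndromeSection m v, sum_column_syndromeSection]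

theorem syndrome_single [DecidableEq F] (ε : BinVec 2 ≃+ F) (i : Fin 12) (k : Fin 11) (c : BinVec 2) :
    syndrome ε i (Pi.single k (ε c)) = column (i.succAbove k - i) c := by
  rw [syndrome_apply, Finset.sum_eq_single k]
  · simp
  · intro b _ hb
    simp [Pi.single_eq_of_ne hb]
  · simp

theorem puncturedCode_dodecacode_le_ker (hF : Nat.card F = 4) {w : F} (hw : w ^ 2 + w + 1 = 0)
    (i : Fin 12) : puncturedCode i (dodecacode w) ≤ (syndrome (symbolEquiv hF hw) i).ker := by
  rw [puncturedCode, dodecacode, AddSubgroup.map_le_iff_le_comap, AddSubgroup.closure_le]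
  rintro _ ⟨s, rfl⟩
  change syndrome (symbolEquiv hF hw) i _ = 0
  rw [syndrome_apply]
  have h : ∀ k, column (i.succAbove k - i) ((symbolEquiv hF hw).symm
      (deleteCoord i (fun j => dodecaWord w (j - s)) k)) =
      column (i.succAbove k - i) (binWord ((i.succAbove k - i) + (i - s))) := by
    intro k
    change column _ ((symbolEquiv hF hw).symm (dodecaWord w (i.succAbove k - s))) = _
    rw [← symbolEquiv_binWord hF hw, AddEquiv.symm_apply_apply, sub_add_sub_cancel]
  rw [Finset.sum_congr rfl fun k _ => h k,
    sum_column_succAbove i fun m => binWord (m + (i - s)), sum_column_binWord]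

theorem binComb_mem {M : Type*} [AddCommGroup M] (C : AddSubgroup M) {l : List M}
    (hl : ∀ a ∈ l, a ∈ C) (m : ℕ) : binComb l m ∈ C := by
  induction l generalizing m with
  | nil => exact zero_mem C
  | cons a t ih =>
    refine add_mem ?_ (ih (fun u h => hl u (List.mem_cons_of_mem _ h)) _)
    split_ifs
    · exact hl a List.mem_cons_self
    · exact zero_mem C

theorem single_add_wordOfSyndrome_mem (hF : Nat.card F = 4) {w : F} (hw : w ^ 2 + w + 1 = 0)
    (i : Fin 12) (k : Fin 11) (a : F) :
    Pi.single k a + wordOfSyndrome (symbolEquiv hF hw) i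
      (syndrome (symbolEquiv hF hw) i (Pi.single k a)) ∈ puncturedCode i (dodecacode w) := by
  classical
  obtain ⟨c, rfl⟩ := (symbolEquiv hF hw).surjective a
  obtain ⟨n, rfl⟩ := exists_ofNat_eq c
  have hpos : ∀ k, i.succAbove k - i ≠ 0 := fun k => sub_ne_zero.2 (i.succAbove_ne k)
  have hgen : ∀ s : Fin 12, deleteCoord i (fun j => dodecaWord w (j - (i + s))) ∈
      puncturedCode i (dodecacode w) := fun s =>
    AddSubgroup.mem_map_of_mem _ (AddSubgroup.subset_closure ⟨i + s, rfl⟩)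
  -- The generators are listed from shift `i` on, which matches the masks computed for the deletion
  -- of coordinate 0.
  have hmem := binComb_mem (puncturedCode i (dodecacode w))
    (l := List.ofFn fun s : Fin 12 => deleteCoord i (fun j => dodecaWord w (j - (i + s))))
    (by
      intro a ha
      obtain ⟨s, rfl⟩ := (List.mem_ofFn' _ _).1 ha
      exact hgen s) (xorComb (codewordMasks (i.succAbove k - i)) n)
  convert hmem using 1
  ext k'
  have h := symbol_add_section_eq_binComb _ (hpos k) n _ (hpos k')
  have h2 := map_binComb (Pi.evalAddMonoidHom (fun _ : Fin 11 => F) k')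
    (List.ofFn fun s : Fin 12 => deleteCoord i (fun j => dodecaWord w (j - (i + s))))
    (xorComb (codewordMasks (i.succAbove k - i)) n)
  rw [Pi.evalAddMonoidHom_apply, List.map_ofFn] at h2
  rw [h2, Pi.add_apply, wordOfSyndrome_apply, syndrome_single]
  have h3 : (Pi.single k (symbolEquiv hF hw (ofNat n)) : Fin 11 → F) k' = symbolEquiv hF hw
      (if i.succAbove k' - i = i.succAbove k - i then ofNat n else 0) := by
    rw [Pi.single_apply]
    simp only [sub_left_inj, Fin.succAbove_right_inj]
    split_ifs <;> simp
  have h4 := map_binComb (symbolEquiv hF hw).toAddMonoidHom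
    (List.ofFn fun s => binWord (i.succAbove k' - i - s))
    (xorComb (codewordMasks (i.succAbove k - i)) n)
  rw [h3, ← map_add, h]
  refine h4.trans ?_
  rw [List.map_ofFn]
  congr 2
  ext s
  change symbolEquiv hF hw (binWord (i.succAbove k' - i - s)) =
    dodecaWord w (i.succAbove k' - (i + s))
  rw [symbolEquiv_binWord, sub_sub]

/-- No dimension count is needed. The map y ↦ y + word(syndrome y) is additive and sends words of
weight at most one into the code, hence every word; on the kernel it is the identity. -/
theorem puncturedCode_dodecacode_eq_ker (hF : Nat.card F = 4) {w : F} (hw : w ^ 2 + w + 1 = 0)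
    (i : Fin 12) : puncturedCode i (dodecacode w) = (syndrome (symbolEquiv hF hw) i).ker := by
  refine le_antisymm (puncturedCode_dodecacode_le_ker hF hw i) fun x hx => ?_
  have key : ∀ y : Fin 11 → F, y + wordOfSyndrome (symbolEquiv hF hw) i
      (syndrome (symbolEquiv hF hw) i y) ∈ puncturedCode i (dodecacode w) := by
    intro y
    let f : (Fin 11 → F) →+ (Fin 11 → F) := AddMonoidHom.id _ +
      (wordOfSyndrome (symbolEquiv hF hw) i).comp (syndrome (symbolEquiv hF hw) i)
    change f y ∈ _
    rw [← Finset.univ_sum_single y, map_sum]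
    exact sum_mem fun k _ => single_add_wordOfSyndrome_mem hF hw i k (y k)
  have h := key x
  rwa [AddMonoidHom.mem_ker.1 hx, map_zero, add_zero] at h

theorem isConn_iff_exists_syndrome [DecidableEq F] (ε : BinVec 2 ≃+ F) (i : Fin 12) (s : BinVec 10) :
    IsConn s ↔ ∃ x : Fin 11 → F, hammingNorm x = 1 ∧ syndrome ε i x = s := by
  constructor
  · intro hs
    obtain ⟨m, hm, c, hc, rfl⟩ := exists_column_eq hs
    obtain ⟨k, hk⟩ := Fin.exists_succAbove_eq (x := m + i) (y := i) (by simpa using hm)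
    refine ⟨Pi.single k (ε c), ?_, ?_⟩
    · rw [hammingNorm, Finset.card_eq_one]
      refine ⟨k, ?_⟩
      ext j
      by_cases h : j = k
      · subst h
        simpa using hc
      · simp [h]
    · rw [syndrome_single, hk, add_sub_cancel_right]
  · rintro ⟨x, hx, rfl⟩
    rw [hammingNorm, Finset.card_eq_one] at hx
    obtain ⟨k, hk⟩ := hx
    have hk' : ∀ j, x j ≠ 0 ↔ j = k := fun j => by simpa using Finset.ext_iff.1 hk j
    obtain ⟨c, hc⟩ := ε.surjective (x k)
    have hx : x = Pi.single k (ε c) := by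
      ext j
      by_cases h : j = k
      · subst h
        simp [hc]
      · rw [Pi.single_eq_of_ne h]
        exact not_not.1 fun h0 => h ((hk' j).1 h0)
    rw [hx, syndrome_single]
    obtain ⟨n, rfl⟩ := exists_ofNat_eq c
    refine isConn_column _ (sub_ne_zero.2 (i.succAbove_ne k)) n ?_
    rintro rfl
    refine (hk' k).2 rfl ?_
    rw [← hc]
    exact map_zero ε

/-- The coset graph of the kernel of a map whose values on the vectors of weight one are the
elements of the connection set. -/
noncomputable def cosetGraphKerIso [DecidableEq F] {n : ℕ} (f : (Fin n → F) →+ BinVec 10)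
    (hf : Function.Surjective f)
    (hconn : ∀ s, IsConn s ↔ ∃ x : Fin n → F, hammingNorm x = 1 ∧ f x = s) :
    cosetGraph f.ker ≃g syndromeGraph where
  toEquiv := (QuotientAddGroup.quotientKerEquivOfSurjective f hf).toEquiv
  map_rel_iff' {a b} := by
    change IsConn (QuotientAddGroup.quotientKerEquivOfSurjective f hf a +
      QuotientAddGroup.quotientKerEquivOfSurjective f hf b) ↔ _
    have hmk : ∀ x : Fin n → F,
        QuotientAddGroup.quotientKerEquivOfSurjective f hf (QuotientAddGroup.mk x) = f x :=
      fun x => rfl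
    rw [← sub_eq_add, ← map_sub, hconn]
    constructor
    · rintro ⟨x, hx, h⟩
      rw [← hmk, EmbeddingLike.apply_eq_iff_eq] at h
      refine ⟨?_, x, hx, h⟩
      rintro rfl
      rw [sub_self] at h
      refine not_isConn_zero ((hconn 0).2 ⟨x, hx, ?_⟩)
      rw [← hmk, h, map_zero]
    · rintro ⟨-, x, hx, h⟩
      exact ⟨x, hx, by rw [← hmk, h]⟩

theorem nonempty_cosetGraph_iso [DecidableEq F] (hF : Nat.card F = 4) {w : F}
    (hw : w ^ 2 + w + 1 = 0) (i : Fin 12) :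
    Nonempty (cosetGraph (puncturedCode i (dodecacode w)) ≃g syndromeGraph) := by
  rw [puncturedCode_dodecacode_eq_ker hF hw i]
  exact ⟨cosetGraphKerIso _ (fun v => ⟨_, syndrome_wordOfSyndrome _ i v⟩)
    (isConn_iff_exists_syndrome _ i)⟩

end Field

/-! ### The theorem for the coset graph -/

theorem mainTheorem7 {F : Type*} [Field F] [DecidableEq F] (hF : Nat.card F = 4)
    (w : F) (hw : w ^ 2 + w + 1 = 0) (i : Fin 12)
    (C : AddSubgroup (Fin 11 → F)) (hC : C = puncturedCode i (dodecacode w))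
    (Γ : SimpleGraph ((Fin 11 → F) ⧸ C)) (hΓ : Γ = cosetGraph C) :
    -- the automorphism group has order `2 ^ 10 * 54` and is transitive on the vertices
    Nat.card (Γ ≃g Γ) = 2 ^ 10 * 54 ∧
    MulAction.IsPretransitive (Γ ≃g Γ) ((Fin 11 → F) ⧸ C) ∧
    -- there are exactly two orbits on the edges
    (∃ O₁ O₂ : Set (Sym2 ((Fin 11 → F) ⧸ C)),
      {O | ∃ e ∈ Γ.edgeSet, O = edgeOrbit Γ e} = {O₁, O₂} ∧
      O₁.ncard = 2 ^ 9 * 6 ∧ O₂.ncard = 2 ^ 9 * 27) ∧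
    -- the vertex stabilizers, with nontrivial actions in both semidirect products
    (∀ v : (Fin 11 → F) ⧸ C,
      ∃ (φ : Multiplicative (ZMod 3) →* MulAut (Multiplicative (ZMod 9)))
        (ψ : Multiplicative (ZMod 2) →*
          MulAut (Multiplicative (ZMod 9) ⋊[φ] Multiplicative (ZMod 3))),
        φ ≠ 1 ∧ ψ ≠ 1 ∧
        Nonempty (MulAction.stabilizer (Γ ≃g Γ) v ≃*
          (Multiplicative (ZMod 9) ⋊[φ] Multiplicative (ZMod 3)) ⋊[ψ] Multiplicative (ZMod 2))) ∧
    -- every automorphism falls under one of the eight cases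
    (∀ g : Γ ≃g Γ,
      HasFixedType Γ g 1 Γ ∨
      (∃ p ∈ ({2, 4, 6, 12, 18} : Set ℕ), HasFixedType Γ g p (⊥ : SimpleGraph (Fin 0))) ∨
      HasFixedType Γ g 2 (disjointCompletes 8 4) ∨
      HasFixedType Γ g 3 (⊥ : SimpleGraph (Fin 4)) ∨
      HasFixedType Γ g 3 (hammingGraph 2 4) ∨
      HasFixedType Γ g 6 (⊥ : SimpleGraph (Fin 2)) ∨
      HasFixedType Γ g 9 (⊥ : SimpleGraph (Fin 1)) ∨
      HasFixedType Γ g 9 (⊤ : SimpleGraph (Fin 4))) ∧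
    -- every case occurs
    (∃ g : Γ ≃g Γ, HasFixedType Γ g 1 Γ) ∧
    (∀ p ∈ ({2, 4, 6, 12, 18} : Set ℕ),
      ∃ g : Γ ≃g Γ, HasFixedType Γ g p (⊥ : SimpleGraph (Fin 0))) ∧
    (∃ g : Γ ≃g Γ, HasFixedType Γ g 2 (disjointCompletes 8 4)) ∧
    (∃ g : Γ ≃g Γ, HasFixedType Γ g 3 (⊥ : SimpleGraph (Fin 4))) ∧
    (∃ g : Γ ≃g Γ, HasFixedType Γ g 3 (hammingGraph 2 4)) ∧
    (∃ g : Γ ≃g Γ, HasFixedType Γ g 6 (⊥ : SimpleGraph (Fin 2))) ∧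
    (∃ g : Γ ≃g Γ, HasFixedType Γ g 9 (⊥ : SimpleGraph (Fin 1))) ∧
    (∃ g : Γ ≃g Γ, HasFixedType Γ g 9 (⊤ : SimpleGraph (Fin 4))) := by
  subst hC hΓ
  obtain ⟨e⟩ := nonempty_cosetGraph_iso hF hw i
  have hcard := (Nat.card_congr (autCongr e).toEquiv).trans syndromeGraph.card_aut
  refine ⟨hcard, ⟨fun a b => ?_⟩, syndromeGraph.hasTwoEdgeOrbits.congr e.symm, fun v => ?_,
    fun g => ?_, syndromeGraph.allFixedTypesOccur.congr e.symm⟩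
  · obtain ⟨g, hg⟩ := syndromeGraph.isPretransitive.exists_smul_eq (e a) (e b)
    refine ⟨(autCongr e).symm g, ?_⟩
    change e.symm (g (e a)) = b
    exact (RelIso.symm_apply_eq e).2 hg
  · refine ⟨stabAction, stabAction', stabAction_ne_one, stabAction'_ne_one, ?_⟩
    obtain ⟨f⟩ := syndromeGraph.nonempty_stabilizer_mulEquiv
    -- A translation carries the stabilizer of zero to that of an arbitrary vertex.
    have ht : (syndromeGraph.translation (e v)) 0 = e v := zero_add _
    have f' := stabilizerCongr (syndromeGraph.translation (e v)) 0
    rw [ht] at f'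
    exact ⟨((stabilizerCongr e v).trans f'.symm).trans f⟩
  · have h := (syndromeGraph.hasListedFixedType (autCongr e g)).congr e.symm
    have hg : autCongr e.symm (autCongr e g) = g := (autCongr e).symm_apply_apply g
    rwa [hg] at h
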